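/- A \emph{tree-like tableau} of size $n\ge 1$ is a Young diagram (left-justified, without empty rows or columns) with $n$ pointed cells such that (1) the top left cell is pointed (the root point); (2) for every non-root point there is either a point above it in its column or a point to its left in its row, but not both; (3) every row and every column contains a point. Let $\mathcal T_n$ be the set of these tableaux; by convention the empty tableau is the unique tree-like tableau of size $0$. A \emph{corner} of $T$ is a cell whose bottom and right edges lie on the southeast border of the diagram, and the \emph{corners in $\mathcal T_n$} are the pairs $(T,c)$ with $T\in\mathcal T_n$ and $c$ a corner of $T$. Let $top(T)$ (resp. $left(T)$) be the number of non-root points in the first row (resp. column) of $T$, and put $top=left=-1$ for the empty tableau. A \emph{non-ambiguous tree} of height $h$ and width $w$ is a tree-like tableau whose shape is a rectangle with $h+1$ rows and $w+1$ columns. With the convention $\sigma_0=n+1$, $\sigma_{n+1}=0$, an \emph{ascending run} of length (or size) $r$ of $\sigma=\sigma_1\cdots\sigma_n\in\mathfrak S_n$ is a sequence $(\sigma_m,\dots,\sigma_{m+r-1})$ with $r\ge1$, $1\le m\le m+r-1\le n$ and $\sigma_{m-1}>\sigma_m<\sigma_{m+1}<\cdots<\sigma_{m+r-1}>\sigma_{m+r}$;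 the runs of size $1$ in $\mathfrak S_n$ are the pairs $(\sigma,m)$ with $\sigma_{m-1}>\sigma_m>\sigma_{m+1}$. \textbf{Theorem.} For every $n\ge1$, the corners in $\mathcal T_n$ are in bijection with the ascending runs of size $1$ in $\mathfrak S_n$. More precisely, there is such a bijection that is the composition of the following two bijections. (a) The map $(T,c)\mapsto(T_l,T_r,nat)$, obtained by cutting $T$ along the lines carrying the bottom and the right edges of $c$, is a bijection from the corners in $\mathcal T_n$ onto the triplets in which $T_l$ and $T_r$ are tree-like tableaux of sizes $n_l,n_r\ge 0$ with $n_l+n_r+1=n$, and $nat$ is a non-ambiguous tree of height $left(T_r)+1$ and width $top(T_l)+1$. Here, if $M$ is the rectangle of all cells weakly above and weakly to the left of $c$, then $T_l$ consists of the rows of $T$ below $c$ together with a new first row that has one cell for each column of $M$ other than the last, this cell being pointed if and only if that column contains a point in $M$; symmetrically, $T_r$ consists of the columns of $T$ to the right of $c$ together with a new first column that has one cell for each row of $M$ other than the last, this cell being pointed if and only if that row contains a point in $M$; and $nat$ is $M$ with its rows and columns without points removed. (b) There is a bijection from these triplets onto the runs of size $1$ in permutations of $[n]$ that sends $(T_l,T_r,nat)$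 to a run $(\sigma_m)$ with $\sigma_m=n_l+1$. -/

import Mathlib

/-- A Young diagram (a left-justified diagram without empty rows or columns) together with a set of
pointed cells. Cells are `(row, column)`, numbered from `0`, starting in the top left corner. -/
@[ext]
structure PointedTableau where
  shape : YoungDiagram
  points : Finset (ℕ × ℕ)
  points_subset : points ⊆ shape.cells

namespace PointedTableau

/-- The size of a tableau is its number of points. -/
def size (T : PointedTableau) : ℕ := T.points.card

/-- The number of rows. -/
def numRows (T : PointedTableau) : ℕ := T.shape.colLen 0

/-- The number of columns. -/
def numCols (T : PointedTableau) : ℕ := T.shape.rowLen 0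

/-- Tree-like tableaux. -/
structure IsTreeLike (T : PointedTableau) : Prop where
  /-- the top left cell is pointed (the root point) -/
  root : (0, 0) ∈ T.points
  /-- every non-root point has a point above it in its column or a point to its left in its row,
  but not both -/
  parent : ∀ i j, (i, j) ∈ T.points → (i, j) ≠ (0, 0) →
    ((∃ i' < i, (i', j) ∈ T.points) ∨ (∃ j' < j, (i, j') ∈ T.points)) ∧
      ¬ ((∃ i' < i, (i', j) ∈ T.points) ∧ (∃ j' < j, (i, j') ∈ T.points))
  /-- every row contains a point -/
  row : ∀ i < T.numRows, ∃ j, (i, j) ∈ T.points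
  /-- every column contains a point -/
  col : ∀ j < T.numCols, ∃ i, (i, j) ∈ T.points

/-- The tableau without any cell. It counts as the unique tree-like tableau of size `0`. -/
def IsEmptyTableau (T : PointedTableau) : Prop := T.shape.cells = ∅

/-- The cell `c` is a corner: its bottom and right edges lie on the southeast border. -/
def IsCorner (T : PointedTableau) (c : ℕ × ℕ) : Prop :=
  c ∈ T.shape.cells ∧ (c.1 + 1, c.2) ∉ T.shape.cells ∧ (c.1, c.2 + 1) ∉ T.shape.cells

/-- The number of points in the first row, the root point included. For a tree-like tableau this is
`top T + 1`, where `top T` counts the non-root points of the first row; for the empty tableau it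
is `0`. -/
def firstRowPoints (T : PointedTableau) : ℕ := (T.points.filter fun p => p.1 = 0).card

/-- The number of points in the first column, the root point included. For a tree-like tableau this
is `left T + 1`, where `left T` counts the non-root points of the first column; for the empty
tableau it is `0`. -/
def firstColPoints (T : PointedTableau) : ℕ := (T.points.filter fun p => p.2 = 0).card

/-- Non-ambiguous trees of height `h` and width `w`: tree-like tableaux of rectangular shape with
`h + 1` rows and `w + 1` columns. -/
def IsNonAmbiguousTree (T : PointedTableau) (h w : ℕ) : Prop :=
  T.IsTreeLike ∧ T.shape.cells = Finset.range (h + 1) ×ˢ Finset.range (w + 1)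

/-- The points of `T` in the rectangle whose bottom right cell is `c`. -/
def middlePoints (T : PointedTableau) (c : ℕ × ℕ) : Finset (ℕ × ℕ) :=
  T.points.filter fun p => p.1 ≤ c.1 ∧ p.2 ≤ c.2

/-- The non-empty rows of the rectangle whose bottom right cell is `c`. -/
def middleRows (T : PointedTableau) (c : ℕ × ℕ) : Finset ℕ := (T.middlePoints c).image Prod.fst

/-- The non-empty columns of the rectangle whose bottom right cell is `c`. -/
def middleCols (T : PointedTableau) (c : ℕ × ℕ) : Finset ℕ := (T.middlePoints c).image Prod.snd

/-- `Tl` is the left part of the cutting of `T` along the bottom and right edges of the corner `c`: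
the rows of `T` below `c`, on top of which one puts a new first row; the new row has one cell for
each column of `T` strictly to the left of `c`, and the cell is pointed iff that column has a point
in the rectangle whose bottom right cell is `c`. -/
structure IsCutLeft (T : PointedTableau) (c : ℕ × ℕ) (Tl : PointedTableau) : Prop where
  shape_zero : ∀ j, (0, j) ∈ Tl.shape.cells ↔ j < c.2
  shape_succ : ∀ i j, (i + 1, j) ∈ Tl.shape.cells ↔ (c.1 + 1 + i, j) ∈ T.shape.cells
  points_zero : ∀ j, (0, j) ∈ Tl.points ↔ j < c.2 ∧ j ∈ T.middleCols c
  points_succ : ∀ i j, (i + 1, j) ∈ Tl.points ↔ (c.1 + 1 + i, j) ∈ T.points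

/-- `Tr` is the right part of the cutting of `T` along the bottom and right edges of the corner `c`:
the columns of `T` to the right of `c`, to the left of which one puts a new first column; the new
column has one cell for each row of `T` strictly above `c`, and the cell is pointed iff that row has
a point in the rectangle whose bottom right cell is `c`. -/
structure IsCutRight (T : PointedTableau) (c : ℕ × ℕ) (Tr : PointedTableau) : Prop where
  shape_zero : ∀ i, (i, 0) ∈ Tr.shape.cells ↔ i < c.1
  shape_succ : ∀ i j, (i, j + 1) ∈ Tr.shape.cells ↔ (i, c.2 + 1 + j) ∈ T.shape.cells
  points_zero : ∀ i, (i, 0) ∈ Tr.points ↔ i < c.1 ∧ i ∈ T.middleRows c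
  points_succ : ∀ i j, (i, j + 1) ∈ Tr.points ↔ (i, c.2 + 1 + j) ∈ T.points

/-- `N` is the middle part of the cutting of `T` along the bottom and right edges of the corner `c`:
the rectangle whose bottom right cell is `c`, from which the rows and the columns without points are
removed. -/
structure IsCutMiddle (T : PointedTableau) (c : ℕ × ℕ) (N : PointedTableau) : Prop where
  shape_eq : N.shape.cells =
    Finset.range (T.middleRows c).card ×ˢ Finset.range (T.middleCols c).card
  points_eq : N.points = (T.middlePoints c).image fun p =>
    (((T.middleRows c).filter (· < p.1)).card, ((T.middleCols c).filter (· < p.2)).card)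

end PointedTableau

open PointedTableau in
/-- The corners of the tree-like tableaux of size `n`: pairs of such a tableau and one of its
corners. -/
def TreeLikeCorner (n : ℕ) : Type :=
  {x : PointedTableau × (ℕ × ℕ) // x.1.IsTreeLike ∧ x.1.size = n ∧ x.1.IsCorner x.2}

/-- Triplets `(Tl, Tr, N)` with `Tl`, `Tr` tree-like tableaux (possibly of size `0`) whose sizes
add up to `n - 1`, and `N` a non-ambiguous tree of height `left Tr + 1` and width `top Tl + 1`. -/
structure CutTriplet (n : ℕ) where
  Tl : PointedTableau
  Tr : PointedTableau
  N : PointedTableau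
  left_treeLike : Tl.IsTreeLike ∨ Tl.IsEmptyTableau
  right_treeLike : Tr.IsTreeLike ∨ Tr.IsEmptyTableau
  size_eq : Tl.size + Tr.size + 1 = n
  nat_tree : N.IsNonAmbiguousTree Tr.firstColPoints Tl.firstRowPoints

/-- The word `σ₁ ⋯ σₙ` of a permutation of `[n]`, with `σ₀ = n + 1` and `σᵢ = 0` for `i > n`.
(`Fin n` stands for `[n]`; positions and values are shifted by one.) -/
def permWord {n : ℕ} (σ : Equiv.Perm (Fin n)) (i : ℕ) : ℕ :=
  if i = 0 then n + 1
  else if h : i - 1 < n then (σ ⟨i - 1, h⟩ : ℕ) + 1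
  else 0

/-- `(σ_m, …, σ_{m+r-1})` is an ascending run (of length `r`) of `σ`. -/
def IsAscendingRun {n : ℕ} (σ : Equiv.Perm (Fin n)) (m r : ℕ) : Prop :=
  1 ≤ r ∧ 1 ≤ m ∧ m + r - 1 ≤ n ∧
    permWord σ (m - 1) > permWord σ m ∧
    (∀ j, m ≤ j → j + 1 ≤ m + r - 1 → permWord σ j < permWord σ (j + 1)) ∧
    permWord σ (m + r - 1) > permWord σ (m + r)

/-- The ascending runs of size `1` in the permutations of `[n]`: pairs of a permutation `σ` and a
position `m` such that `(σ_m)` is an ascending run of `σ`. -/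
def SizeOneRun (n : ℕ) : Type :=
  {x : Equiv.Perm (Fin n) × ℕ // IsAscendingRun x.1 x.2 1}

/-! Cutting loses no information. Below or to the right of the corner, the parent condition only
asks whether some point lies above or to the left, so the marks in the new first row of `Tl` and the
new first column of `Tr` can replace the whole rectangle `M`. Conversely, these marks say where
empty rows and columns must be reinserted into the non-ambiguous tree to recover `M`; the row and
the column of the corner itself are never empty in `M`. Sizes add up because the size of a tree-like
tableau plus one is its number of rows plus its number of columns (`IsTreeLike.size_add_one`).

The second bijection is not explicit. For sizes `a = n_l` and `b = n_r`, the triplets and the runs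
with letter `a + 1` are both counted by `(a + b - 1)! (a + b + a b)`, or by `1` if `a = b = 0`;
arbitrary bijections between the fibres are then glued.

The triplets are counted by stripping last rows. The leftmost point of the last row has a point
above it, provided this row is not the first; the other points of the row are alone in their
columns, and these columns disappear with the row. With the binomial theorem this recursion yields
two formulas. The sum of `x ^ (top + 1)` over the tableaux of size `n` is `x (x + 1) ⋯ (x + n - 1)`
(`sum_treeLikeOrEmptyFinset`). The number of non-ambiguous trees of height `h` and width `w` is the
value at `u = 1` of `D ^ h` applied to `u ^ w`, where `D f (u) = (u + 1) f (u + 1) - u f (u)`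
(`card_nonAmbiguousTreeFinset`). By linearity in `D ^ h` and in `u ^ w`, summing over `Tl` and `Tr`
gives `D (D + 1) ⋯ (D + b - 1)` applied to `u (u + 1) ⋯ (u + a - 1)` at `u = 1`, and this has a
closed form (`risingDiffMul_risingFun_succ`).

For the runs, the letter `a + 1` contributes `a (a + b - 1)!` in the first position, `b (a + b -
1)!` in the last one and `a b (a + b - 2)!` in each of the `a + b - 1` others, as soon as `a + b >
0`. -/

/-! ### Ranks in a finite set: inserting and deleting empty rows and columns -/

/-- The number of elements of `S` below `i`. -/
def rankIn (S : Finset ℕ) (i : ℕ) : ℕ := (S.filter (· < i)).card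

theorem rankIn_lt_rankIn {S : Finset ℕ} {i j : ℕ} (hi : i ∈ S) (h : i < j) :
    rankIn S i < rankIn S j := by
  apply Finset.card_lt_card
  rw [Finset.ssubset_iff_of_subset (fun x hx => by
    simp only [Finset.mem_filter] at hx ⊢; exact ⟨hx.1, hx.2.trans h⟩)]
  exact ⟨i, by simp [hi, h], by simp⟩

theorem rankIn_mono (S : Finset ℕ) : Monotone (rankIn S) := fun i j h =>
  Finset.card_le_card fun x hx => by
    simp only [Finset.mem_filter] at hx ⊢; exact ⟨hx.1, hx.2.trans_le h⟩

theorem rankIn_lt_iff {S : Finset ℕ} {i j : ℕ} (hi : i ∈ S) :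
    rankIn S i < rankIn S j ↔ i < j :=
  ⟨fun h => lt_of_not_ge fun h' => (rankIn_mono S h').not_gt h, rankIn_lt_rankIn hi⟩

theorem rankIn_injOn (S : Finset ℕ) : Set.InjOn (rankIn S) S := fun i hi j hj h => by
  rcases lt_trichotomy i j with h' | h' | h'
  · exact absurd h (rankIn_lt_rankIn hi h').ne
  · exact h'
  · exact absurd h (rankIn_lt_rankIn hj h').ne'

theorem rankIn_lt_card {S : Finset ℕ} {i : ℕ} (hi : i ∈ S) : rankIn S i < S.card := by
  apply Finset.card_lt_card
  rw [Finset.ssubset_iff_of_subset (Finset.filter_subset _ _)]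
  exact ⟨i, hi, by simp⟩

theorem exists_rankIn_eq {S : Finset ℕ} {k : ℕ} (hk : k < S.card) : ∃ i ∈ S, rankIn S i = k := by
  have h : S.image (rankIn S) = Finset.range S.card := by
    apply Finset.eq_of_subset_of_card_le
    · intro x hx
      obtain ⟨i, hi, rfl⟩ := Finset.mem_image.1 hx
      exact Finset.mem_range.2 (rankIn_lt_card hi)
    · rw [Finset.card_image_of_injOn (rankIn_injOn S), Finset.card_range]
  simpa using h.ge (Finset.mem_range.2 hk)

theorem rankIn_zero (S : Finset ℕ) : rankIn S 0 = 0 := by simp [rankIn]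

/-- If `A` is obtained from `B` by inserting empty rows and columns, then a cell of `A` has a point
above it iff the corresponding cell of `B` has one. -/
theorem exists_above_iff {A B : Finset (ℕ × ℕ)} {R C : Finset ℕ}
    (hB : ∀ i j, (i, j) ∈ B → i < R.card)
    (h : ∀ i j, (i, j) ∈ A ↔ i ∈ R ∧ j ∈ C ∧ (rankIn R i, rankIn C j) ∈ B)
    {i j : ℕ} (hj : j ∈ C) :
    (∃ i' < i, (i', j) ∈ A) ↔ ∃ i' < rankIn R i, (i', rankIn C j) ∈ B := by
  constructor
  · rintro ⟨i', hi', hA⟩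
    have := (h _ _).1 hA
    exact ⟨rankIn R i', rankIn_lt_rankIn this.1 hi', this.2.2⟩
  · rintro ⟨k, hk, hkB⟩
    obtain ⟨i', hi', rfl⟩ := exists_rankIn_eq (hB _ _ hkB)
    exact ⟨i', (rankIn_lt_iff hi').1 hk, (h _ _).2 ⟨hi', hj, hkB⟩⟩

/-- If `A` is obtained from `B` by inserting empty rows and columns, then a cell of `A` has a point
to its left iff the corresponding cell of `B` has one. -/
theorem exists_left_iff {A B : Finset (ℕ × ℕ)} {R C : Finset ℕ}
    (hB : ∀ i j, (i, j) ∈ B → j < C.card)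
    (h : ∀ i j, (i, j) ∈ A ↔ i ∈ R ∧ j ∈ C ∧ (rankIn R i, rankIn C j) ∈ B)
    {i j : ℕ} (hi : i ∈ R) :
    (∃ j' < j, (i, j') ∈ A) ↔ ∃ j' < rankIn C j, (rankIn R i, j') ∈ B := by
  constructor
  · rintro ⟨j', hj', hA⟩
    have := (h _ _).1 hA
    exact ⟨rankIn C j', rankIn_lt_rankIn this.2.1 hj', this.2.2⟩
  · rintro ⟨k, hk, hkB⟩
    obtain ⟨j', hj', rfl⟩ := exists_rankIn_eq (hB _ _ hkB)
    exact ⟨j', (rankIn_lt_iff hj').1 hk, (h _ _).2 ⟨hi, hj', hkB⟩⟩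

/-! ### Tableaux, transposition and the size formula -/

namespace PointedTableau

theorem ext_mem {T T' : PointedTableau} (hs : ∀ i j, (i, j) ∈ T.shape ↔ (i, j) ∈ T'.shape)
    (hp : ∀ i j, (i, j) ∈ T.points ↔ (i, j) ∈ T'.points) : T = T' := by
  apply PointedTableau.ext
  · ext ⟨i, j⟩; exact hs i j
  · ext ⟨i, j⟩; exact hp i j

theorem mem_shape_of_mem_points {T : PointedTableau} {c : ℕ × ℕ} (h : c ∈ T.points) :
    c ∈ T.shape := T.points_subset h

theorem mem_shape_of_le {T : PointedTableau} {i j i' j' : ℕ} (h : (i, j) ∈ T.shape)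
    (hi : i' ≤ i) (hj : j' ≤ j) : (i', j') ∈ T.shape :=
  T.shape.up_left_mem hi hj h

/-- A tableau is given by its cells and its points. -/
theorem exists_of_mem (p q : ℕ → ℕ → Prop) (N : ℕ) (hN : ∀ i j, p i j → i < N ∧ j < N)
    (hp : ∀ i j i' j', p i j → i' ≤ i → j' ≤ j → p i' j') (hq : ∀ i j, q i j → p i j) :
    ∃ T : PointedTableau, (∀ i j, (i, j) ∈ T.shape ↔ p i j) ∧
      ∀ i j, (i, j) ∈ T.points ↔ q i j := by
  classical
  let s := (Finset.range N ×ˢ Finset.range N).filter fun x => p x.1 x.2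
  let t := (Finset.range N ×ˢ Finset.range N).filter fun x => q x.1 x.2
  have hs : ∀ i j, (i, j) ∈ s ↔ p i j := fun i j => by
    simp only [s, Finset.mem_filter, Finset.mem_product, Finset.mem_range]
    exact ⟨fun h => h.2, fun h => ⟨hN _ _ h, h⟩⟩
  have ht : ∀ i j, (i, j) ∈ t ↔ q i j := fun i j => by
    simp only [t, Finset.mem_filter, Finset.mem_product, Finset.mem_range]
    exact ⟨fun h => h.2, fun h => ⟨hN _ _ (hq _ _ h), h⟩⟩
  refine ⟨⟨⟨s, ?_⟩, t, ?_⟩, hs, ht⟩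
  · rintro ⟨i, j⟩ ⟨i', j'⟩ ⟨h1, h2⟩ h
    exact (hs _ _).2 (hp _ _ _ _ ((hs _ _).1 h) h1 h2)
  · rintro ⟨i, j⟩ h
    exact (hs _ _).2 (hq _ _ ((ht _ _).1 h))

theorem lt_numRows_iff {T : PointedTableau} {i : ℕ} : i < T.numRows ↔ (i, 0) ∈ T.shape :=
  YoungDiagram.mem_iff_lt_colLen.symm

theorem lt_numCols_iff {T : PointedTableau} {j : ℕ} : j < T.numCols ↔ (0, j) ∈ T.shape :=
  YoungDiagram.mem_iff_lt_rowLen.symm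

theorem lt_numRows {T : PointedTableau} {i j : ℕ} (h : (i, j) ∈ T.shape) : i < T.numRows :=
  lt_numRows_iff.2 (mem_shape_of_le h le_rfl (Nat.zero_le _))

theorem lt_numCols {T : PointedTableau} {i j : ℕ} (h : (i, j) ∈ T.shape) : j < T.numCols :=
  lt_numCols_iff.2 (mem_shape_of_le h (Nat.zero_le _) le_rfl)

theorem numRows_eq {T : PointedTableau} {r : ℕ} (h : ∀ i, (i, 0) ∈ T.shape ↔ i < r) :
    T.numRows = r :=
  le_antisymm (not_lt.1 fun h' => ((h _).1 (lt_numRows_iff.1 h')).false)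
    (not_lt.1 fun h' => (lt_numRows_iff.2 ((h _).2 h')).false)

theorem numCols_eq {T : PointedTableau} {r : ℕ} (h : ∀ i, (0, i) ∈ T.shape ↔ i < r) :
    T.numCols = r :=
  le_antisymm (not_lt.1 fun hlt => ((h _).1 (lt_numCols_iff.1 hlt)).false)
    (not_lt.1 fun hlt => (lt_numCols_iff.2 ((h _).2 hlt)).false)

/-- Reflection in the main diagonal. -/
def transpose (T : PointedTableau) : PointedTableau where
  shape := T.shape.transpose
  points := T.points.image Prod.swap
  points_subset := by
    intro x hx
    obtain ⟨y, hy, rfl⟩ := Finset.mem_image.1 hx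
    rw [YoungDiagram.mem_cells, YoungDiagram.mem_transpose, Prod.swap_swap]
    exact T.points_subset hy

@[simp] theorem mem_transpose_shape {T : PointedTableau} {i j : ℕ} :
    (i, j) ∈ T.transpose.shape ↔ (j, i) ∈ T.shape :=
  YoungDiagram.mem_transpose

@[simp] theorem mem_transpose_points {T : PointedTableau} {i j : ℕ} :
    (i, j) ∈ T.transpose.points ↔ (j, i) ∈ T.points := by
  simp [transpose]

theorem transpose_transpose (T : PointedTableau) : T.transpose.transpose = T :=
  ext_mem (by simp) (by simp)

theorem transpose_size (T : PointedTableau) : T.transpose.size = T.size :=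
  Finset.card_image_of_injective _ Prod.swap_injective

theorem transpose_numRows (T : PointedTableau) : T.transpose.numRows = T.numCols :=
  numRows_eq fun _ => by rw [mem_transpose_shape, lt_numCols_iff]

theorem transpose_numCols (T : PointedTableau) : T.transpose.numCols = T.numRows :=
  numCols_eq fun _ => by rw [mem_transpose_shape, lt_numRows_iff]

theorem transpose_firstRowPoints (T : PointedTableau) :
    T.transpose.firstRowPoints = T.firstColPoints := by
  rw [firstRowPoints, firstColPoints, transpose, Finset.filter_image,
    Finset.card_image_of_injective _ Prod.swap_injective]
  rfl

theorem IsTreeLike.transpose {T : PointedTableau} (h : T.IsTreeLike) :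
    T.transpose.IsTreeLike where
  root := by simpa using h.root
  parent i j hij h0 := by
    simp only [mem_transpose_points] at *
    have := h.parent j i hij (by simp only [ne_eq, Prod.mk.injEq] at *; tauto)
    exact ⟨this.1.symm, fun h => this.2 h.symm⟩
  row i hi := by
    rw [transpose_numRows] at hi
    simpa using h.col i hi
  col i hi := by
    rw [transpose_numCols] at hi
    simpa using h.row i hi

theorem isEmptyTableau_iff {T : PointedTableau} :
    T.IsEmptyTableau ↔ ∀ i j, (i, j) ∉ T.shape := by
  rw [IsEmptyTableau, Finset.eq_empty_iff_forall_notMem]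
  exact ⟨fun h i j => h (i, j), fun h x => h x.1 x.2⟩

theorem IsEmptyTableau.transpose {T : PointedTableau} (h : T.IsEmptyTableau) :
    T.transpose.IsEmptyTableau := by
  rw [isEmptyTableau_iff] at *
  simpa using fun i j => h j i

theorem IsEmptyTableau.points {T : PointedTableau} (h : T.IsEmptyTableau) : T.points = ∅ :=
  Finset.subset_empty.1 (h ▸ T.points_subset)

/-- Below the first row, the leftmost point of a row has nothing to its left, so it must have a
point above. Conversely, "not both" makes a point with a point above it the leftmost one of its row.
So these points correspond to the rows other than the first. -/
theorem IsTreeLike.card_with_above {T : PointedTableau} (h : T.IsTreeLike) :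
    (T.points.filter fun p => ∃ i' < p.1, (i', p.2) ∈ T.points).card + 1 = T.numRows := by
  have hr : 0 < T.numRows := lt_numRows (mem_shape_of_mem_points h.root)
  have : (T.points.filter fun p => ∃ i' < p.1, (i', p.2) ∈ T.points).card
      = (Finset.Ico 1 T.numRows).card := by
    refine Finset.card_bij (fun p _ => p.1) ?_ ?_ ?_
    · rintro ⟨i, j⟩ hp
      obtain ⟨hp, i', hi', -⟩ := Finset.mem_filter.1 hp
      exact Finset.mem_Ico.2 ⟨Nat.succ_le_of_lt (Nat.zero_lt_of_lt hi'),
        lt_numRows (mem_shape_of_mem_points hp)⟩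
    · have key : ∀ i j j', (i, j) ∈ T.points → (i, j') ∈ T.points →
          (∃ i' < i, (i', j) ∈ T.points) → ¬ j' < j := by
        intro i j j' hp hp' ha hlt
        refine (h.parent i j hp ?_).2 ⟨ha, j', hlt, hp'⟩
        rintro h0
        simp only [Prod.mk.injEq] at h0
        omega
      rintro ⟨i, j⟩ hp ⟨i', j'⟩ hp' heq
      simp only at heq
      subst heq
      obtain ⟨hp, ha⟩ := Finset.mem_filter.1 hp
      obtain ⟨hp', ha'⟩ := Finset.mem_filter.1 hp'
      have h1 := key _ _ _ hp hp' ha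
      have h2 := key _ _ _ hp' hp ha'
      rw [Prod.mk.injEq]
      exact ⟨rfl, by omega⟩
    · intro i hi
      obtain ⟨h1, h2⟩ := Finset.mem_Ico.1 hi
      classical
      have hex := h.row i h2
      refine ⟨(i, Nat.find hex), ?_, rfl⟩
      have hpt := Nat.find_spec hex
      refine Finset.mem_filter.2 ⟨hpt, ?_⟩
      refine (h.parent _ _ hpt ?_).1.resolve_right ?_
      · simp only [ne_eq, Prod.mk.injEq]; omega
      · rintro ⟨j', hj', hp'⟩
        exact Nat.find_min hex hj' hp'
  rw [this, Nat.card_Ico]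
  omega

/-- Non-root points split into those with a point above, one for each row but the first, and those
with a point to the left, one for each column but the first. -/
theorem IsTreeLike.size_add_one {T : PointedTableau} (h : T.IsTreeLike) :
    T.size + 1 = T.numRows + T.numCols := by
  have h1 := h.card_with_above
  have h2 := h.transpose.card_with_above
  rw [transpose_numRows] at h2
  have h3 : (T.transpose.points.filter
        fun p => ∃ i' < p.1, (i', p.2) ∈ T.transpose.points).card
      = (T.points.filter fun p => ∃ j' < p.2, (p.1, j') ∈ T.points).card := by
    rw [PointedTableau.transpose, Finset.filter_image,
      Finset.card_image_of_injective _ Prod.swap_injective]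
    congr 1
    ext ⟨i, j⟩
    simp
  have h4 : T.points = insert (0, 0)
      ((T.points.filter fun p => ∃ i' < p.1, (i', p.2) ∈ T.points) ∪
        T.points.filter fun p => ∃ j' < p.2, (p.1, j') ∈ T.points) := by
    ext ⟨i, j⟩
    simp only [Finset.mem_insert, Finset.mem_union, Finset.mem_filter]
    constructor
    · intro hp
      by_cases h0 : (i, j) = (0, 0)
      · exact Or.inl h0
      · have := (h.parent i j hp h0).1
        exact Or.inr (this.imp (⟨hp, ·⟩) (⟨hp, ·⟩))
    · rintro (h0 | h0 | h0)
      · rw [h0]; exact h.root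
      · exact h0.1
      · exact h0.1
  have h5 : T.size = _ := congrArg Finset.card h4
  rw [Finset.card_insert_of_notMem (by simp), Finset.card_union_of_disjoint] at h5
  · omega
  · rw [Finset.disjoint_left]
    rintro ⟨i, j⟩ ha hb
    obtain ⟨hp, ha⟩ := Finset.mem_filter.1 ha
    obtain ⟨-, hb⟩ := Finset.mem_filter.1 hb
    refine (h.parent i j hp ?_).2 ⟨ha, hb⟩
    obtain ⟨i', hi', -⟩ := ha
    simp only [ne_eq, Prod.mk.injEq]; simp only at hi'; omega

end PointedTableau

theorem eq_zero_of_rankIn_eq_zero {S : Finset ℕ} {i : ℕ} (h0 : 0 ∈ S) (h : rankIn S i = 0) :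
    i = 0 := by
  by_contra hi
  have := rankIn_lt_rankIn h0 (Nat.pos_of_ne_zero hi)
  omega

/-! ### Cutting a tableau at a corner -/

namespace PointedTableau

section Cut

variable {T Tl Tr N : PointedTableau} {c : ℕ × ℕ}

theorem mem_middlePoints {i j : ℕ} :
    (i, j) ∈ T.middlePoints c ↔ (i, j) ∈ T.points ∧ i ≤ c.1 ∧ j ≤ c.2 := by
  simp [middlePoints]

theorem mem_middleRows {i : ℕ} :
    i ∈ T.middleRows c ↔ i ≤ c.1 ∧ ∃ j ≤ c.2, (i, j) ∈ T.points := by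
  simp only [middleRows, Finset.mem_image, Prod.exists, mem_middlePoints]
  constructor
  · rintro ⟨i, j, ⟨h1, h2, h3⟩, rfl⟩
    exact ⟨h2, j, h3, h1⟩
  · rintro ⟨h2, j, h3, h1⟩
    exact ⟨i, j, ⟨h1, h2, h3⟩, rfl⟩

theorem mem_middleCols {j : ℕ} :
    j ∈ T.middleCols c ↔ j ≤ c.2 ∧ ∃ i ≤ c.1, (i, j) ∈ T.points := by
  simp only [middleCols, Finset.mem_image, Prod.exists, mem_middlePoints]
  constructor
  · rintro ⟨i, j, ⟨h1, h2, h3⟩, rfl⟩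
    exact ⟨h3, i, h2, h1⟩
  · rintro ⟨h2, i, h3, h1⟩
    exact ⟨i, j, ⟨h1, h3, h2⟩, rfl⟩

theorem transpose_middleRows : T.transpose.middleRows c.swap = T.middleCols c := by
  ext; simp [mem_middleRows, mem_middleCols]

theorem transpose_middleCols : T.transpose.middleCols c.swap = T.middleRows c := by
  ext; simp [mem_middleRows, mem_middleCols]

theorem IsCorner.transpose (hc : T.IsCorner c) : T.transpose.IsCorner c.swap :=
  ⟨mem_transpose_shape.2 hc.1, fun h => hc.2.2 (mem_transpose_shape.1 h),
    fun h => hc.2.1 (mem_transpose_shape.1 h)⟩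

theorem IsCutLeft.transpose (h : T.IsCutLeft c Tl) :
    T.transpose.IsCutRight c.swap Tl.transpose where
  shape_zero j := mem_transpose_shape.trans (h.shape_zero j)
  shape_succ i j := mem_transpose_shape.trans ((h.shape_succ j i).trans mem_transpose_shape.symm)
  points_zero j := by
    rw [mem_transpose_points, transpose_middleRows]; exact h.points_zero j
  points_succ i j := by
    rw [mem_transpose_points, mem_transpose_points]; exact h.points_succ j i

theorem IsCutRight.transpose (h : T.IsCutRight c Tr) :
    T.transpose.IsCutLeft c.swap Tr.transpose where
  shape_zero j := mem_transpose_shape.trans (h.shape_zero j)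
  shape_succ i j := mem_transpose_shape.trans ((h.shape_succ j i).trans mem_transpose_shape.symm)
  points_zero j := by
    rw [mem_transpose_points, transpose_middleCols]; exact h.points_zero j
  points_succ i j := by
    rw [mem_transpose_points, mem_transpose_points]; exact h.points_succ j i

theorem IsCorner.lt_right (hc : T.IsCorner c) {i j : ℕ} (h : (i, j) ∈ T.shape) (hi : c.1 < i) :
    j < c.2 :=
  lt_of_not_ge fun h' => hc.2.1 (mem_shape_of_le h hi h')

theorem IsCorner.lt_bottom (hc : T.IsCorner c) {i j : ℕ} (h : (i, j) ∈ T.shape) (hj : c.2 < j) :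
    i < c.1 :=
  lt_of_not_ge fun h' => hc.2.2 (mem_shape_of_le h h' hj)

theorem IsCorner.mem_of_le (hc : T.IsCorner c) {i j : ℕ} (hi : i ≤ c.1) (hj : j ≤ c.2) :
    (i, j) ∈ T.shape :=
  mem_shape_of_le (T := T) (i := c.1) (j := c.2) hc.1 hi hj

theorem exists_isCutLeft (hc : T.IsCorner c) : ∃ Tl, T.IsCutLeft c Tl := by
  obtain ⟨Tl, h1, h2⟩ := exists_of_mem
    (fun i j => (i = 0 ∧ j < c.2) ∨ (0 < i ∧ (c.1 + i, j) ∈ T.shape))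
    (fun i j => (i = 0 ∧ j < c.2 ∧ j ∈ T.middleCols c) ∨ (0 < i ∧ (c.1 + i, j) ∈ T.points))
    (T.numRows + T.numCols + c.2 + 1)
    (by
      rintro i j (⟨h, h'⟩ | ⟨h, h'⟩)
      · omega
      · have := lt_numRows h'
        have := lt_numCols h'
        omega)
    (by
      rintro i j i' j' (⟨h, h'⟩ | ⟨h, h'⟩) hi hj
      · left; omega
      · rcases Nat.eq_zero_or_pos i' with h0 | h0
        · left
          have := hc.lt_right h' (by omega)
          omega
        · right
          exact ⟨h0, mem_shape_of_le h' (by omega) hj⟩)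
    (by
      rintro i j (⟨h, h', -⟩ | ⟨h, h'⟩)
      · exact Or.inl ⟨h, h'⟩
      · exact Or.inr ⟨h, mem_shape_of_mem_points h'⟩)
  refine ⟨Tl, ⟨fun j => ?_, fun i j => ?_, fun j => ?_, fun i j => ?_⟩⟩
  · rw [YoungDiagram.mem_cells, h1]; simp
  · rw [YoungDiagram.mem_cells, h1, YoungDiagram.mem_cells, show c.1 + 1 + i = c.1 + (i + 1) by ring]
    simp
  · rw [h2]; simp
  · rw [h2, show c.1 + 1 + i = c.1 + (i + 1) by ring]; simp

theorem exists_isCutRight (hc : T.IsCorner c) : ∃ Tr, T.IsCutRight c Tr := by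
  obtain ⟨Tr, h⟩ := exists_isCutLeft hc.transpose
  refine ⟨Tr.transpose, ?_⟩
  have := h.transpose
  rwa [transpose_transpose, Prod.swap_swap] at this

/-- Ranks are injective on the nonempty rows and columns, so compressing the rectangle is reversible
once these two sets are known. The parent conditions are transferred in this form. -/
theorem IsCutMiddle.mem_iff (h : T.IsCutMiddle c N) {i j : ℕ} :
    (i, j) ∈ T.middlePoints c ↔ i ∈ T.middleRows c ∧ j ∈ T.middleCols c ∧
      (rankIn (T.middleRows c) i, rankIn (T.middleCols c) j) ∈ N.points := by
  rw [h.points_eq, Finset.mem_image]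
  constructor
  · intro hp
    exact ⟨Finset.mem_image_of_mem Prod.fst hp, Finset.mem_image_of_mem Prod.snd hp,
      _, hp, rfl⟩
  · rintro ⟨hi, hj, ⟨i', j'⟩, hp, heq⟩
    have h1 := rankIn_injOn _ (Finset.mem_image_of_mem Prod.fst hp) hi (congrArg Prod.fst heq)
    have h2 := rankIn_injOn _ (Finset.mem_image_of_mem Prod.snd hp) hj (congrArg Prod.snd heq)
    simp only at h1 h2
    rwa [h1, h2] at hp

theorem IsCutMiddle.mem_shape (h : T.IsCutMiddle c N) {i j : ℕ} :
    (i, j) ∈ N.shape ↔ i < (T.middleRows c).card ∧ j < (T.middleCols c).card := by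
  rw [← YoungDiagram.mem_cells, h.shape_eq]; simp

theorem IsCutMiddle.of_mem_iff
    (hs : ∀ i j, (i, j) ∈ N.shape ↔ i < (T.middleRows c).card ∧ j < (T.middleCols c).card)
    (hp : ∀ i j, (i, j) ∈ T.middlePoints c ↔ i ∈ T.middleRows c ∧ j ∈ T.middleCols c ∧
      (rankIn (T.middleRows c) i, rankIn (T.middleCols c) j) ∈ N.points) :
    T.IsCutMiddle c N where
  shape_eq := by
    ext ⟨i, j⟩
    rw [YoungDiagram.mem_cells, hs]; simp
  points_eq := by
    ext ⟨i, j⟩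
    rw [Finset.mem_image]
    constructor
    · intro h
      obtain ⟨h1, h2⟩ := (hs _ _).1 (mem_shape_of_mem_points h)
      obtain ⟨i', hi', rfl⟩ := exists_rankIn_eq h1
      obtain ⟨j', hj', rfl⟩ := exists_rankIn_eq h2
      exact ⟨(i', j'), (hp _ _).2 ⟨hi', hj', h⟩, rfl⟩
    · rintro ⟨⟨i', j'⟩, h, heq⟩
      rw [← heq]
      exact ((hp _ _).1 h).2.2

theorem exists_isCutMiddle (T : PointedTableau) (c : ℕ × ℕ) : ∃ N, T.IsCutMiddle c N := by
  obtain ⟨N, h1, h2⟩ := exists_of_mem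
    (fun i j => i < (T.middleRows c).card ∧ j < (T.middleCols c).card)
    (fun i j => ∃ i' j', (i', j') ∈ T.middlePoints c ∧
      rankIn (T.middleRows c) i' = i ∧ rankIn (T.middleCols c) j' = j)
    ((T.middleRows c).card + (T.middleCols c).card)
    (by rintro i j ⟨h1, h2⟩; omega)
    (by rintro i j i' j' ⟨h1, h2⟩ h3 h4; omega)
    (by
      rintro _ _ ⟨i, j, h, rfl, rfl⟩
      exact ⟨rankIn_lt_card (Finset.mem_image_of_mem Prod.fst h),
        rankIn_lt_card (Finset.mem_image_of_mem Prod.snd h)⟩)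
  refine ⟨N, IsCutMiddle.of_mem_iff h1 fun i j => ?_⟩
  rw [h2]
  constructor
  · intro h
    exact ⟨Finset.mem_image_of_mem Prod.fst h, Finset.mem_image_of_mem Prod.snd h, i, j, h, rfl, rfl⟩
  · rintro ⟨hi, hj, i', j', h, h3, h4⟩
    rwa [← rankIn_injOn _ (Finset.mem_image_of_mem Prod.fst h) hi h3,
      ← rankIn_injOn _ (Finset.mem_image_of_mem Prod.snd h) hj h4]

/-- The new first row marks the columns with a point in the rectangle, so it can stand for all the
rows down to that of `c` when only the existence of a point above matters. -/
theorem IsCutLeft.above_iff (h : T.IsCutLeft c Tl) {i j : ℕ} (hj : j < c.2) :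
    (∃ i' < c.1 + 1 + i, (i', j) ∈ T.points) ↔ ∃ i' < i + 1, (i', j) ∈ Tl.points := by
  constructor
  · rintro ⟨i', hi', hp⟩
    rcases Nat.lt_or_ge c.1 i' with hlt | hle
    · obtain ⟨k, rfl⟩ := Nat.exists_eq_add_of_le (Nat.succ_le_of_lt hlt)
      exact ⟨k + 1, by omega, (h.points_succ _ _).2 hp⟩
    · exact ⟨0, Nat.succ_pos _, (h.points_zero _).2 ⟨hj, mem_middleCols.2 ⟨hj.le, i', hle, hp⟩⟩⟩
  · rintro ⟨i', hi', hp⟩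
    rcases i' with - | i'
    · obtain ⟨-, i', hi', hp⟩ := mem_middleCols.1 ((h.points_zero _).1 hp).2
      exact ⟨i', by omega, hp⟩
    · exact ⟨c.1 + 1 + i', by omega, (h.points_succ _ _).1 hp⟩

theorem IsCutLeft.left_iff (h : T.IsCutLeft c Tl) {i j : ℕ} :
    (∃ j' < j, (c.1 + 1 + i, j') ∈ T.points) ↔ ∃ j' < j, (i + 1, j') ∈ Tl.points := by
  simp_rw [h.points_succ]

theorem IsCutRight.left_iff (h : T.IsCutRight c Tr) {i j : ℕ} (hi : i < c.1) :
    (∃ j' < c.2 + 1 + j, (i, j') ∈ T.points) ↔ ∃ j' < j + 1, (i, j') ∈ Tr.points := by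
  simpa using h.transpose.above_iff (i := j) hi

theorem IsCutRight.above_iff (h : T.IsCutRight c Tr) {i j : ℕ} :
    (∃ i' < i, (i', c.2 + 1 + j) ∈ T.points) ↔ ∃ i' < i, (i', j + 1) ∈ Tr.points := by
  simpa using h.transpose.left_iff (i := j) (j := i)

/-- If `c` lies in the first column, nothing remains. Otherwise the root of `T` marks the first cell
of the new row and serves as left ancestor for the other marks, while the points of the lower rows
keep their parent conditions. -/
theorem IsCutLeft.treeLike_or_empty (h : T.IsCutLeft c Tl) (hT : T.IsTreeLike)
    (hc : T.IsCorner c) : Tl.IsTreeLike ∨ Tl.IsEmptyTableau := by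
  rcases Nat.eq_zero_or_pos c.2 with h0 | h0
  · right
    rw [isEmptyTableau_iff]
    intro i j hij
    have := (h.shape_zero j).1 (mem_shape_of_le hij (Nat.zero_le _) le_rfl)
    omega
  left
  have hroot : (0, 0) ∈ Tl.points := (h.points_zero 0).2
    ⟨h0, mem_middleCols.2 ⟨Nat.zero_le _, 0, Nat.zero_le _, hT.root⟩⟩
  have hlt : ∀ {i j}, (i, j) ∈ Tl.points → j < c.2 := fun hp =>
    (h.shape_zero _).1 (mem_shape_of_le (mem_shape_of_mem_points hp) (Nat.zero_le _) le_rfl)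
  refine ⟨hroot, ?_, ?_, ?_⟩
  · rintro (- | i) j hp hne
    · refine ⟨Or.inr ⟨0, ?_, hroot⟩, fun h' => ?_⟩
      · simp only [ne_eq, Prod.mk.injEq, true_and] at hne
        omega
      · obtain ⟨⟨i', hi', -⟩, -⟩ := h'
        omega
    · rw [← h.left_iff, ← h.above_iff (hlt hp)]
      exact hT.parent _ _ ((h.points_succ _ _).1 hp) (by simp)
  · rintro (- | i) hi
    · exact ⟨0, hroot⟩
    · obtain ⟨j, hj⟩ := hT.row (c.1 + 1 + i)
        (lt_numRows_iff.2 ((h.shape_succ _ _).1 (lt_numRows_iff.1 hi)))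
      exact ⟨j, (h.points_succ _ _).2 hj⟩
  · intro j hj
    have hj' : j < c.2 := (h.shape_zero j).1 (lt_numCols_iff.1 hj)
    obtain ⟨i, hi⟩ := hT.col j (lt_numCols_iff.2 (hc.mem_of_le (Nat.zero_le _) hj'.le))
    obtain ⟨i', -, hi'⟩ := (h.above_iff (i := i) hj').1 ⟨i, by omega, hi⟩
    exact ⟨i', hi'⟩

theorem IsCutRight.treeLike_or_empty (h : T.IsCutRight c Tr) (hT : T.IsTreeLike)
    (hc : T.IsCorner c) : Tr.IsTreeLike ∨ Tr.IsEmptyTableau := by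
  rw [← transpose_transpose Tr]
  exact (h.transpose.treeLike_or_empty hT.transpose hc.transpose).imp
    IsTreeLike.transpose IsEmptyTableau.transpose

/-- The column of a corner ends at the corner, so every point of it lies in the rectangle. -/
theorem IsTreeLike.snd_mem_middleCols (hT : T.IsTreeLike) (hc : T.IsCorner c) :
    c.2 ∈ T.middleCols c := by
  obtain ⟨i, hi⟩ := hT.col c.2 (lt_numCols (T := T) (i := c.1) hc.1)
  refine mem_middleCols.2 ⟨le_rfl, i, ?_, hi⟩
  exact not_lt.1 fun h => (hc.lt_right (mem_shape_of_mem_points hi) h).false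

theorem IsTreeLike.fst_mem_middleRows (hT : T.IsTreeLike) (hc : T.IsCorner c) :
    c.1 ∈ T.middleRows c := by
  rw [← transpose_middleCols]
  exact hT.transpose.snd_mem_middleCols hc.transpose

/-- The column of `c` is nonempty but has no cell in the first row of `Tl`, whence the extra `1`.
The compressed rectangle thus has width `Tl.firstRowPoints`, which is `top + 1`. -/
theorem IsCutLeft.card_middleCols (h : T.IsCutLeft c Tl) (hc : c.2 ∈ T.middleCols c) :
    (T.middleCols c).card = Tl.firstRowPoints + 1 := by
  rw [← Finset.card_erase_add_one hc, add_left_inj, firstRowPoints]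
  refine Finset.card_bij (fun j _ => (0, j)) ?_ ?_ ?_
  · intro j hj
    obtain ⟨h1, h2⟩ := Finset.mem_erase.1 hj
    have := (mem_middleCols.1 h2).1
    exact Finset.mem_filter.2 ⟨(h.points_zero j).2 ⟨by omega, h2⟩, rfl⟩
  · intro j _ j' _ h
    exact congrArg Prod.snd h
  · rintro ⟨i, j⟩ hp
    obtain ⟨hp, h0⟩ := Finset.mem_filter.1 hp
    simp only at h0
    subst h0
    obtain ⟨h1, h2⟩ := (h.points_zero j).1 hp
    exact ⟨j, Finset.mem_erase.2 ⟨h1.ne, h2⟩, rfl⟩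

theorem IsCutRight.card_middleRows (h : T.IsCutRight c Tr) (hc : c.1 ∈ T.middleRows c) :
    (T.middleRows c).card = Tr.firstColPoints + 1 := by
  rw [← transpose_middleCols, ← transpose_firstRowPoints]
  exact h.transpose.card_middleCols (by rwa [transpose_middleCols])

theorem IsCutMiddle.above_iff (h : T.IsCutMiddle c N) {i j : ℕ} (hp : (i, j) ∈ T.middlePoints c) :
    (∃ i' < i, (i', j) ∈ T.points) ↔ ∃ i' < rankIn (T.middleRows c) i,
      (i', rankIn (T.middleCols c) j) ∈ N.points := by
  rw [← exists_above_iff (A := T.middlePoints c)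
    (fun i j hB => (h.mem_shape.1 (mem_shape_of_mem_points hB)).1)
    (fun i j => h.mem_iff) (h.mem_iff.1 hp).2.1]
  have := mem_middlePoints.1 hp
  refine exists_congr fun i' => and_congr_right fun hi' => ?_
  rw [mem_middlePoints]
  exact ⟨fun h => ⟨h, by omega, this.2.2⟩, fun h => h.1⟩

theorem IsCutMiddle.left_iff (h : T.IsCutMiddle c N) {i j : ℕ} (hp : (i, j) ∈ T.middlePoints c) :
    (∃ j' < j, (i, j') ∈ T.points) ↔ ∃ j' < rankIn (T.middleCols c) j,
      (rankIn (T.middleRows c) i, j') ∈ N.points := by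
  rw [← exists_left_iff (A := T.middlePoints c)
    (fun i j hB => (h.mem_shape.1 (mem_shape_of_mem_points hB)).2)
    (fun i j => h.mem_iff) (h.mem_iff.1 hp).1]
  have := mem_middlePoints.1 hp
  refine exists_congr fun i' => and_congr_right fun hi' => ?_
  rw [mem_middlePoints]
  exact ⟨fun h => ⟨h, this.2.1, by omega⟩, fun h => h.1⟩

theorem IsCutMiddle.isNonAmbiguousTree (h : T.IsCutMiddle c N) (hT : T.IsTreeLike)
    {a b : ℕ} (ha : (T.middleRows c).card = a + 1) (hb : (T.middleCols c).card = b + 1) :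
    N.IsNonAmbiguousTree a b := by
  refine ⟨⟨?_, ?_, ?_, ?_⟩, ?_⟩
  · have := (h.mem_iff.1 (mem_middlePoints.2 ⟨hT.root, Nat.zero_le _, Nat.zero_le _⟩)).2.2
    rwa [rankIn_zero, rankIn_zero] at this
  · intro i j hp hne
    obtain ⟨h1, h2⟩ := h.mem_shape.1 (mem_shape_of_mem_points hp)
    obtain ⟨i, hi, rfl⟩ := exists_rankIn_eq h1
    obtain ⟨j, hj, rfl⟩ := exists_rankIn_eq h2
    have hm := h.mem_iff.2 ⟨hi, hj, hp⟩
    rw [← h.above_iff hm, ← h.left_iff hm]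
    refine hT.parent i j (mem_middlePoints.1 hm).1 fun h0 => hne ?_
    rw [Prod.mk.injEq] at h0
    rw [h0.1, h0.2, rankIn_zero, rankIn_zero]
  · intro i hi'
    obtain ⟨i, hi, rfl⟩ := exists_rankIn_eq (h.mem_shape.1 (lt_numRows_iff.1 hi')).1
    obtain ⟨h1, j, hj, hp⟩ := mem_middleRows.1 hi
    exact ⟨_, (h.mem_iff.1 (mem_middlePoints.2 ⟨hp, h1, hj⟩)).2.2⟩
  · intro j hj'
    obtain ⟨j, hj, rfl⟩ := exists_rankIn_eq (h.mem_shape.1 (lt_numCols_iff.1 hj')).2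
    obtain ⟨h1, i, hi, hp⟩ := mem_middleCols.1 hj
    exact ⟨_, (h.mem_iff.1 (mem_middlePoints.2 ⟨hp, hi, h1⟩)).2.2⟩
  · rw [h.shape_eq, ha, hb]

/-- Both sides come from shapes alone: a nonempty `Tl` has `c.2` columns and `T.numRows - c.1` rows.
If `Tl` is empty, then `c.2 = 0` and `c` is in the last row, so the same formula holds with size
`0`. -/
theorem IsCutLeft.size_add (h : T.IsCutLeft c Tl) (hT : T.IsTreeLike) (hc : T.IsCorner c) :
    Tl.size + c.1 + 1 = T.numRows + c.2 := by
  rcases h.treeLike_or_empty hT hc with hl | hl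
  · have h0 : 0 < c.2 := (h.shape_zero 0).1 (mem_shape_of_mem_points hl.root)
    have h1 : Tl.numCols = c.2 := numCols_eq h.shape_zero
    have h3 : c.1 < T.numRows := lt_numRows (T := T) (j := c.2) hc.1
    have h2 : Tl.numRows = T.numRows - c.1 := numRows_eq fun i => by
      rcases i with - | i
      · exact ⟨fun _ => by omega, fun _ => (h.shape_zero 0).2 h0⟩
      · refine (h.shape_succ _ _).trans (Iff.trans lt_numRows_iff.symm ?_)
        omega
    have := hl.size_add_one
    omega
  · have h0 : c.2 = 0 := by
      by_contra h0
      exact isEmptyTableau_iff.1 hl _ _ ((h.shape_zero 0).2 (by omega))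
    have h2 : T.numRows = c.1 + 1 := numRows_eq fun i =>
      ⟨fun h => by
        by_contra h'
        have := hc.lt_right h (by omega)
        omega, fun h => hc.mem_of_le (by omega) (by omega)⟩
    rw [size, hl.points, h2, h0]
    simp

theorem IsCutRight.size_add (h : T.IsCutRight c Tr) (hT : T.IsTreeLike) (hc : T.IsCorner c) :
    Tr.size + c.2 + 1 = T.numCols + c.1 := by
  rw [← transpose_size, ← transpose_numRows]
  exact h.transpose.size_add hT.transpose hc.transpose

theorem size_eq_of_cut (hl : T.IsCutLeft c Tl) (hr : T.IsCutRight c Tr) (hT : T.IsTreeLike)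
    (hc : T.IsCorner c) : Tl.size + Tr.size + 1 = T.size := by
  have h1 := hl.size_add hT hc
  have h2 := hr.size_add hT hc
  have h3 := hT.size_add_one
  omega

/-- A cell of `T` is below the corner, to its right, or in the rectangle; its parent condition is
the one of its image in `Tl`, `Tr` or `N` respectively. -/
theorem isTreeLike_of_cut (hl : T.IsCutLeft c Tl) (hr : T.IsCutRight c Tr)
    (hm : T.IsCutMiddle c N) (hc : T.IsCorner c)
    (hTl : Tl.IsTreeLike ∨ Tl.IsEmptyTableau) (hTr : Tr.IsTreeLike ∨ Tr.IsEmptyTableau)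
    (hN : N.IsTreeLike) (hrow : c.1 ∈ T.middleRows c) (hcol : c.2 ∈ T.middleCols c) :
    T.IsTreeLike := by
  have hTl' : ∀ {i j}, (i, j) ∈ Tl.shape → Tl.IsTreeLike := fun h =>
    hTl.resolve_right fun h' => isEmptyTableau_iff.1 h' _ _ h
  have hTr' : ∀ {i j}, (i, j) ∈ Tr.shape → Tr.IsTreeLike := fun h =>
    hTr.resolve_right fun h' => isEmptyTableau_iff.1 h' _ _ h
  -- Row `0` of `N` must come from row `0` of `T`, so that roots match. The root of `Tr` marks that
  -- row, unless `c` itself is in the first row, where the hypothesis on the row of `c` applies.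
  have hR : 0 ∈ T.middleRows c := by
    rcases Nat.eq_zero_or_pos c.1 with h0 | h0
    · rwa [h0] at hrow
    · exact ((hr.points_zero 0).1 (hTr' ((hr.shape_zero 0).2 h0)).root).2
  have hC : 0 ∈ T.middleCols c := by
    rcases Nat.eq_zero_or_pos c.2 with h0 | h0
    · rwa [h0] at hcol
    · exact ((hl.points_zero 0).1 (hTl' ((hl.shape_zero 0).2 h0)).root).2
  refine ⟨?_, ?_, ?_, ?_⟩
  · refine (mem_middlePoints.1 (hm.mem_iff.2 ⟨hR, hC, ?_⟩)).1
    rw [rankIn_zero, rankIn_zero]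
    exact hN.root
  · intro i j hp hne
    have hs := mem_shape_of_mem_points hp
    rcases Nat.lt_or_ge c.1 i with hi | hi
    · have hj := hc.lt_right hs hi
      obtain ⟨i, rfl⟩ := Nat.exists_eq_add_of_le (Nat.succ_le_of_lt hi)
      have hp' := (hl.points_succ i j).2 hp
      rw [Nat.succ_eq_add_one, hl.above_iff hj, hl.left_iff]
      exact (hTl' (mem_shape_of_mem_points hp')).parent _ _ hp' (by simp)
    rcases Nat.lt_or_ge c.2 j with hj | hj
    · have hi := hc.lt_bottom hs hj
      obtain ⟨j, rfl⟩ := Nat.exists_eq_add_of_le (Nat.succ_le_of_lt hj)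
      have hp' := (hr.points_succ i j).2 hp
      rw [Nat.succ_eq_add_one, hr.above_iff, hr.left_iff hi]
      exact (hTr' (mem_shape_of_mem_points hp')).parent _ _ hp' (by simp)
    have hp' := mem_middlePoints.2 ⟨hp, hi, hj⟩
    rw [hm.above_iff hp', hm.left_iff hp']
    obtain ⟨h1, h2, h3⟩ := hm.mem_iff.1 hp'
    refine hN.parent _ _ h3 fun h0 => ?_
    rw [Prod.mk.injEq] at h0
    apply hne
    rw [eq_zero_of_rankIn_eq_zero hR h0.1, eq_zero_of_rankIn_eq_zero hC h0.2]
  · intro i hi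
    have hi := lt_numRows_iff.1 hi
    rcases Nat.lt_trichotomy i c.1 with h | h | h
    · obtain ⟨j, hj⟩ := (hTr' ((hr.shape_zero i).2 h)).row i
        (lt_numRows_iff.2 ((hr.shape_zero i).2 h))
      obtain ⟨j', -, hj'⟩ := (hr.left_iff (j := j) h).2 ⟨j, by omega, hj⟩
      exact ⟨j', hj'⟩
    · obtain ⟨-, j, -, hj⟩ := mem_middleRows.1 hrow
      exact ⟨j, h ▸ hj⟩
    · obtain ⟨i, rfl⟩ := Nat.exists_eq_add_of_le (Nat.succ_le_of_lt h)
      have hs := (hl.shape_succ i 0).2 hi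
      obtain ⟨j, hj⟩ := (hTl' hs).row _ (lt_numRows_iff.2 hs)
      exact ⟨j, (hl.points_succ _ _).1 hj⟩
  · intro i hi
    have hi := lt_numCols_iff.1 hi
    rcases Nat.lt_trichotomy i c.2 with h | h | h
    · obtain ⟨j, hj⟩ := (hTl' ((hl.shape_zero i).2 h)).col i
        (lt_numCols_iff.2 ((hl.shape_zero i).2 h))
      obtain ⟨j', -, hj'⟩ := (hl.above_iff (i := j) h).2 ⟨j, by omega, hj⟩
      exact ⟨j', hj'⟩
    · obtain ⟨-, j, -, hj⟩ := mem_middleCols.1 hcol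
      exact ⟨j, h ▸ hj⟩
    · obtain ⟨i, rfl⟩ := Nat.exists_eq_add_of_le (Nat.succ_le_of_lt h)
      have hs := (hr.shape_succ 0 i).2 hi
      obtain ⟨j, hj⟩ := (hTr' hs).col _ (lt_numCols_iff.2 hs)
      exact ⟨j, (hr.points_succ _ _).1 hj⟩

end Cut

end PointedTableau

/-! ### Gluing the three pieces back together -/

namespace PointedTableau

theorem firstRowPoints_eq_card (T : PointedTableau) :
    T.firstRowPoints = ((Finset.range T.numCols).filter fun j => (0, j) ∈ T.points).card := by
  symm
  refine Finset.card_bij (fun j _ => (0, j)) ?_ ?_ ?_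
  · intro j hj
    exact Finset.mem_filter.2 ⟨(Finset.mem_filter.1 hj).2, rfl⟩
  · intro j _ j' _ h
    exact congrArg Prod.snd h
  · rintro ⟨i, j⟩ hp
    obtain ⟨hp, h0⟩ := Finset.mem_filter.1 hp
    simp only at h0
    subst h0
    exact ⟨j, Finset.mem_filter.2
      ⟨Finset.mem_range.2 (lt_numCols (mem_shape_of_mem_points hp)), hp⟩, rfl⟩

theorem firstColPoints_eq_card (T : PointedTableau) :
    T.firstColPoints = ((Finset.range T.numRows).filter fun i => (i, 0) ∈ T.points).card := by
  rw [← transpose_firstRowPoints, firstRowPoints_eq_card, transpose_numCols]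
  simp

theorem IsNonAmbiguousTree.mem_shape {N : PointedTableau} {h w : ℕ}
    (hN : N.IsNonAmbiguousTree h w) {i j : ℕ} : (i, j) ∈ N.shape ↔ i < h + 1 ∧ j < w + 1 := by
  rw [← YoungDiagram.mem_cells, hN.2]; simp

/-- The corner must be `(Tr.numRows, Tl.numCols)`, which is also right for empty pieces. The
nonempty rows `R` of the rectangle are those marked in the first column of `Tr` and the row of the
corner, and similarly for `C`. The height and width of `N` are exactly what is needed to spread `N`
over `R × C`. -/
theorem exists_cut_eq {Tl Tr N : PointedTableau}
    (hTl : Tl.IsTreeLike ∨ Tl.IsEmptyTableau) (hTr : Tr.IsTreeLike ∨ Tr.IsEmptyTableau)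
    (hN : N.IsNonAmbiguousTree Tr.firstColPoints Tl.firstRowPoints) :
    ∃ (T : PointedTableau) (c : ℕ × ℕ), T.IsTreeLike ∧ T.IsCorner c ∧ T.IsCutLeft c Tl ∧
      T.IsCutRight c Tr ∧
      T.IsCutMiddle c N := by
  set a := Tr.numRows with ha
  set b := Tl.numCols with hb
  set R := insert a ((Finset.range a).filter fun i => (i, 0) ∈ Tr.points) with hR
  set C := insert b ((Finset.range b).filter fun j => (0, j) ∈ Tl.points) with hC
  have hRc : R.card = Tr.firstColPoints + 1 := by
    rw [firstColPoints_eq_card, Finset.card_insert_of_notMem (by simp)]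
  have hCc : C.card = Tl.firstRowPoints + 1 := by
    rw [firstRowPoints_eq_card, Finset.card_insert_of_notMem (by simp)]
  have hRle : ∀ i ∈ R, i ≤ a := by
    intro i hi
    simp only [hR, Finset.mem_insert, Finset.mem_filter, Finset.mem_range] at hi
    omega
  have hCle : ∀ i ∈ C, i ≤ b := by
    intro i hi
    simp only [hC, Finset.mem_insert, Finset.mem_filter, Finset.mem_range] at hi
    omega
  obtain ⟨T, h1, h2⟩ := exists_of_mem
    (fun i j => (i ≤ a ∧ j ≤ b) ∨ (a < i ∧ (i - a, j) ∈ Tl.shape) ∨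
      (b < j ∧ (i, j - b) ∈ Tr.shape))
    (fun i j => (i ∈ R ∧ j ∈ C ∧ (rankIn R i, rankIn C j) ∈ N.points) ∨
      (a < i ∧ (i - a, j) ∈ Tl.points) ∨ (b < j ∧ (i, j - b) ∈ Tr.points))
    (Tl.numRows + a + b + Tr.numCols + 1)
    (by
      rintro i j (h | h | h)
      · omega
      · have := lt_numRows h.2
        have := lt_numCols h.2
        omega
      · have := lt_numRows h.2
        have := lt_numCols h.2
        omega)
    (by
      rintro i j i' j' (h | h | h) hi hj
      · omega
      · have := lt_numCols h.2
        rcases Nat.lt_or_ge a i' with hi' | hi'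
        · exact Or.inr (Or.inl ⟨hi', mem_shape_of_le h.2 (by omega) hj⟩)
        · omega
      · have := lt_numRows h.2
        rcases Nat.lt_or_ge b j' with hi' | hi'
        · exact Or.inr (Or.inr ⟨hi', mem_shape_of_le h.2 hi (by omega)⟩)
        · omega)
    (by
      rintro i j (h | h | h)
      · exact Or.inl ⟨hRle i h.1, hCle j h.2.1⟩
      · exact Or.inr (Or.inl ⟨h.1, mem_shape_of_mem_points h.2⟩)
      · exact Or.inr (Or.inr ⟨h.1, mem_shape_of_mem_points h.2⟩))
  have hmid : ∀ i j, (i, j) ∈ T.middlePoints (a, b) ↔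
      i ∈ R ∧ j ∈ C ∧ (rankIn R i, rankIn C j) ∈ N.points := by
    intro i j
    rw [mem_middlePoints, h2]
    constructor
    · rintro ⟨h | h | h, hi, hj⟩
      · exact h
      · simp only at hi; omega
      · simp only at hj; omega
    · intro h
      exact ⟨Or.inl h, hRle i h.1, hCle j h.2.1⟩
  have hrows : T.middleRows (a, b) = R := by
    ext i
    simp only [middleRows, Finset.mem_image, Prod.exists]
    constructor
    · rintro ⟨i, j, h, rfl⟩
      exact ((hmid i j).1 h).1
    · intro hi
      obtain ⟨k, hk⟩ := hN.1.row (rankIn R i)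
        (lt_numRows_iff.2 (hN.mem_shape.2 ⟨hRc ▸ rankIn_lt_card hi, by omega⟩))
      obtain ⟨j, hj, rfl⟩ := exists_rankIn_eq
        (hCc ▸ (hN.mem_shape.1 (mem_shape_of_mem_points hk)).2 : k < C.card)
      exact ⟨i, j, (hmid i j).2 ⟨hi, hj, hk⟩, rfl⟩
  have hcols : T.middleCols (a, b) = C := by
    ext j
    simp only [middleCols, Finset.mem_image, Prod.exists]
    constructor
    · rintro ⟨i, j, h, rfl⟩
      exact ((hmid i j).1 h).2.1
    · intro hj
      obtain ⟨k, hk⟩ := hN.1.col (rankIn C j)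
        (lt_numCols_iff.2 (hN.mem_shape.2 ⟨by omega, hCc ▸ rankIn_lt_card hj⟩))
      obtain ⟨i, hi, rfl⟩ := exists_rankIn_eq
        (hRc ▸ (hN.mem_shape.1 (mem_shape_of_mem_points hk)).1 : k < R.card)
      exact ⟨i, j, (hmid i j).2 ⟨hi, hj, hk⟩, rfl⟩
  have hc : T.IsCorner (a, b) := by
    refine ⟨(h1 a b).2 (Or.inl ⟨le_rfl, le_rfl⟩), fun h => ?_, fun h => ?_⟩
    · rcases (h1 _ _).1 h with h | h | h
      · omega
      · have := lt_numCols h.2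
        omega
      · omega
    · rcases (h1 _ _).1 h with h | h | h
      · omega
      · omega
      · have := lt_numRows h.2
        omega
  have hl : T.IsCutLeft (a, b) Tl := by
    refine ⟨fun j => lt_numCols_iff.symm, fun i j => ?_, fun j => ?_, fun i j => ?_⟩
    · rw [YoungDiagram.mem_cells, YoungDiagram.mem_cells, h1,
        show a + 1 + i - a = i + 1 by omega]
      constructor
      · exact fun h => Or.inr (Or.inl ⟨by omega, h⟩)
      · rintro (h | h | h)
        · omega
        · exact h.2
        · have := lt_numRows h.2
          omega
    · rw [hcols, hC, Finset.mem_insert, Finset.mem_filter, Finset.mem_range]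
      constructor
      · intro h
        have := lt_numCols (mem_shape_of_mem_points h)
        exact ⟨this, Or.inr ⟨this, h⟩⟩
      · rintro ⟨h, h' | h'⟩
        · simp only at h; omega
        · exact h'.2
    · rw [h2, show a + 1 + i - a = i + 1 by omega]
      constructor
      · exact fun h => Or.inr (Or.inl ⟨by omega, h⟩)
      · rintro (h | h | h)
        · have := hRle _ h.1
          omega
        · exact h.2
        · have := lt_numRows (mem_shape_of_mem_points h.2)
          omega
  have hr : T.IsCutRight (a, b) Tr := by
    refine ⟨fun j => lt_numRows_iff.symm, fun i j => ?_, fun j => ?_, fun i j => ?_⟩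
    · rw [YoungDiagram.mem_cells, YoungDiagram.mem_cells, h1,
        show b + 1 + j - b = j + 1 by omega]
      constructor
      · exact fun h => Or.inr (Or.inr ⟨by omega, h⟩)
      · rintro (h | h | h)
        · omega
        · have := lt_numCols h.2
          omega
        · exact h.2
    · rw [hrows, hR, Finset.mem_insert, Finset.mem_filter, Finset.mem_range]
      constructor
      · intro h
        have := lt_numRows (mem_shape_of_mem_points h)
        exact ⟨this, Or.inr ⟨this, h⟩⟩
      · rintro ⟨h, h' | h'⟩
        · simp only at h; omega
        · exact h'.2
    · rw [h2, show b + 1 + j - b = j + 1 by omega]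
      constructor
      · exact fun h => Or.inr (Or.inr ⟨by omega, h⟩)
      · rintro (h | h | h)
        · have := hCle _ h.2.1
          omega
        · have := lt_numCols (mem_shape_of_mem_points h.2)
          omega
        · exact h.2
  have hm : T.IsCutMiddle (a, b) N := by
    apply IsCutMiddle.of_mem_iff
    · intro i j
      rw [hrows, hcols, hRc, hCc, hN.mem_shape]
    · intro i j
      rw [hrows, hcols, hmid]
  refine ⟨T, (a, b), isTreeLike_of_cut hl hr hm hc hTl hTr hN.1 ?_ ?_, hc, hl, hr, hm⟩
  · rw [hrows]; exact Finset.mem_insert_self _ _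
  · rw [hcols]; exact Finset.mem_insert_self _ _

/-- The lengths of the first column of `Tr` and of the first row of `Tl` give the corner, their
marks give the nonempty rows and columns, and then each of the three zones is read from its own
piece. -/
theorem eq_of_cut_eq {T T' Tl Tr N : PointedTableau} {c c' : ℕ × ℕ}
    (hT : T.IsTreeLike) (hT' : T'.IsTreeLike) (hc : T.IsCorner c) (hc' : T'.IsCorner c')
    (hl : T.IsCutLeft c Tl) (hl' : T'.IsCutLeft c' Tl)
    (hr : T.IsCutRight c Tr) (hr' : T'.IsCutRight c' Tr)
    (hm : T.IsCutMiddle c N) (hm' : T'.IsCutMiddle c' N) : T = T' ∧ c = c' := by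
  have hcc : c = c' := by
    have h1 : ∀ j, j < c.1 ↔ j < c'.1 := fun j => (hr.shape_zero j).symm.trans (hr'.shape_zero j)
    have h2 : ∀ j, j < c.2 ↔ j < c'.2 := fun j => (hl.shape_zero j).symm.trans (hl'.shape_zero j)
    have h3 := h1 c.1
    have h4 := h1 c'.1
    have h5 := h2 c.2
    have h6 := h2 c'.2
    ext <;> omega
  subst hcc
  have hR : T.middleRows c = T'.middleRows c := by
    ext i
    rcases Nat.lt_trichotomy i c.1 with h | h | h
    · have := (hr.points_zero i).symm.trans (hr'.points_zero i)
      simpa [h] using this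
    · subst h
      exact iff_of_true (hT.fst_mem_middleRows hc) (hT'.fst_mem_middleRows hc')
    · exact iff_of_false (fun h' => (mem_middleRows.1 h').1.not_gt h)
        (fun h' => (mem_middleRows.1 h').1.not_gt h)
  have hC : T.middleCols c = T'.middleCols c := by
    ext i
    rcases Nat.lt_trichotomy i c.2 with h | h | h
    · have := (hl.points_zero i).symm.trans (hl'.points_zero i)
      simpa [h] using this
    · subst h
      exact iff_of_true (hT.snd_mem_middleCols hc) (hT'.snd_mem_middleCols hc')
    · exact iff_of_false (fun h' => (mem_middleCols.1 h').1.not_gt h)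
        (fun h' => (mem_middleCols.1 h').1.not_gt h)
  refine ⟨ext_mem (fun i j => ?_) (fun i j => ?_), rfl⟩
  · rcases Nat.lt_or_ge c.1 i with hi | hi
    · obtain ⟨i, rfl⟩ := Nat.exists_eq_add_of_le (Nat.succ_le_of_lt hi)
      exact (hl.shape_succ i j).symm.trans (hl'.shape_succ i j)
    rcases Nat.lt_or_ge c.2 j with hj | hj
    · obtain ⟨j, rfl⟩ := Nat.exists_eq_add_of_le (Nat.succ_le_of_lt hj)
      exact (hr.shape_succ i j).symm.trans (hr'.shape_succ i j)
    exact iff_of_true (hc.mem_of_le hi hj) (hc'.mem_of_le hi hj)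
  · rcases Nat.lt_or_ge c.1 i with hi | hi
    · obtain ⟨i, rfl⟩ := Nat.exists_eq_add_of_le (Nat.succ_le_of_lt hi)
      exact (hl.points_succ i j).symm.trans (hl'.points_succ i j)
    rcases Nat.lt_or_ge c.2 j with hj | hj
    · obtain ⟨j, rfl⟩ := Nat.exists_eq_add_of_le (Nat.succ_le_of_lt hj)
      exact (hr.points_succ i j).symm.trans (hr'.points_succ i j)
    have h1 : (i, j) ∈ T.points ↔ (i, j) ∈ T.middlePoints c := by
      simp [mem_middlePoints, hi, hj]
    have h2 : (i, j) ∈ T'.points ↔ (i, j) ∈ T'.middlePoints c := by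
      simp [mem_middlePoints, hi, hj]
    rw [h1, h2, hm.mem_iff, hm'.mem_iff, hR, hC]

theorem eq_of_isCutLeft {T Tl Tl' : PointedTableau} {c : ℕ × ℕ}
    (hl : T.IsCutLeft c Tl) (hl' : T.IsCutLeft c Tl') : Tl = Tl' := by
  refine ext_mem (fun i j => ?_) (fun i j => ?_)
  · rcases i with - | i
    · exact (hl.shape_zero j).trans (hl'.shape_zero j).symm
    · exact (hl.shape_succ i j).trans (hl'.shape_succ i j).symm
  · rcases i with - | i
    · exact (hl.points_zero j).trans (hl'.points_zero j).symm
    · exact (hl.points_succ i j).trans (hl'.points_succ i j).symm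

theorem eq_of_isCutRight {T Tr Tr' : PointedTableau} {c : ℕ × ℕ}
    (hr : T.IsCutRight c Tr) (hr' : T.IsCutRight c Tr') : Tr = Tr' := by
  rw [← transpose_transpose Tr, eq_of_isCutLeft hr.transpose hr'.transpose, transpose_transpose]

theorem eq_of_isCutMiddle {T N N' : PointedTableau} {c : ℕ × ℕ}
    (hm : T.IsCutMiddle c N) (hm' : T.IsCutMiddle c N') : N = N' := by
  apply PointedTableau.ext
  · ext1
    rw [hm.shape_eq, hm'.shape_eq]
  · rw [hm.points_eq, hm'.points_eq]

end PointedTableau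

open PointedTableau

theorem CutTriplet.ext' {n : ℕ} {t t' : CutTriplet n} (h1 : t.Tl = t'.Tl) (h2 : t.Tr = t'.Tr)
    (h3 : t.N = t'.N) : t = t' := by
  cases t; cases t'; simp only at h1 h2 h3; subst h1 h2 h3; rfl

theorem exists_cutTriplet {n : ℕ} (x : TreeLikeCorner n) : ∃ t : CutTriplet n,
    x.1.1.IsCutLeft x.1.2 t.Tl ∧ x.1.1.IsCutRight x.1.2 t.Tr ∧ x.1.1.IsCutMiddle x.1.2 t.N := by
  obtain ⟨⟨T, c⟩, hT, hn, hc⟩ := x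
  obtain ⟨Tl, hl⟩ := exists_isCutLeft hc
  obtain ⟨Tr, hr⟩ := exists_isCutRight hc
  obtain ⟨N, hm⟩ := exists_isCutMiddle T c
  exact ⟨⟨Tl, Tr, N, hl.treeLike_or_empty hT hc, hr.treeLike_or_empty hT hc,
    (size_eq_of_cut hl hr hT hc).trans hn,
    hm.isNonAmbiguousTree hT (hr.card_middleRows (hT.fst_mem_middleRows hc))
      (hl.card_middleCols (hT.snd_mem_middleCols hc))⟩, hl, hr, hm⟩

/-- Cutting a tree-like tableau at a corner is a bijection. -/
theorem exists_cut_equiv (n : ℕ) : ∃ cut : TreeLikeCorner n ≃ CutTriplet n,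
    ∀ x : TreeLikeCorner n,
      IsCutLeft x.1.1 x.1.2 (cut x).Tl ∧ IsCutRight x.1.1 x.1.2 (cut x).Tr ∧
        IsCutMiddle x.1.1 x.1.2 (cut x).N := by
  choose f hf using exists_cutTriplet (n := n)
  refine ⟨Equiv.ofBijective f ⟨?_, ?_⟩, hf⟩
  · intro x y h
    obtain ⟨hl, hr, hm⟩ := hf x
    rw [h] at hl hr hm
    obtain ⟨hl', hr', hm'⟩ := hf y
    obtain ⟨h1, h2⟩ := eq_of_cut_eq x.2.1 y.2.1 x.2.2.2 y.2.2.2 hl hl' hr hr' hm hm'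
    exact Subtype.ext (Prod.ext h1 h2)
  · intro t
    obtain ⟨T, c, hT, hc, hl, hr, hm⟩ :=
      exists_cut_eq t.left_treeLike t.right_treeLike t.nat_tree
    let x : TreeLikeCorner n := ⟨(T, c), hT, (size_eq_of_cut hl hr hT hc).symm.trans t.size_eq, hc⟩
    obtain ⟨hl₂, hr₂, hm₂⟩ := hf x
    exact ⟨x, CutTriplet.ext' (eq_of_isCutLeft hl₂ hl) (eq_of_isCutRight hr₂ hr)
      (eq_of_isCutMiddle hm₂ hm)⟩

/-! ### Adding and removing a last row -/

/-- The elements of `D` other than its least element. -/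
def nonMin (D : Finset ℕ) : Finset ℕ := D.filter fun d => ∃ c ∈ D, c < d

theorem mem_nonMin {D : Finset ℕ} {d : ℕ} : d ∈ nonMin D ↔ d ∈ D ∧ ∃ c ∈ D, c < d := by
  simp [nonMin]

theorem nonMin_subset (D : Finset ℕ) : nonMin D ⊆ D := Finset.filter_subset _ _

theorem zero_notMem_nonMin (D : Finset ℕ) : 0 ∉ nonMin D := by simp [mem_nonMin]

theorem exists_eq_insert_nonMin {D : Finset ℕ} (h : D.Nonempty) :
    ∃ c, c ∉ nonMin D ∧ D = insert c (nonMin D) ∧ ∀ d ∈ nonMin D, c < d := by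
  have hc := D.min'_mem h
  refine ⟨D.min' h, ?_, ?_, ?_⟩
  · rw [mem_nonMin]
    rintro ⟨-, d, hd, hlt⟩
    exact (D.min'_le d hd).not_gt hlt
  · ext d
    rw [Finset.mem_insert, mem_nonMin]
    constructor
    · intro hd
      rcases (D.min'_le d hd).eq_or_lt with h' | h'
      · exact Or.inl h'.symm
      · exact Or.inr ⟨hd, _, hc, h'⟩
    · rintro (h' | h')
      · exact h' ▸ hc
      · exact h'.1
  · intro d hd
    obtain ⟨hd, c, hc, hlt⟩ := mem_nonMin.1 hd
    exact (D.min'_le c hc).trans_lt hlt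

theorem card_nonMin {D : Finset ℕ} (h : D.Nonempty) : (nonMin D).card + 1 = D.card := by
  obtain ⟨c, hc, hD, -⟩ := exists_eq_insert_nonMin h
  conv_rhs => rw [hD]
  rw [Finset.card_insert_of_notMem hc]

theorem rankIn_range_sdiff {E : Finset ℕ} {n m : ℕ} (hm : m ≤ n) (hE : E ⊆ Finset.range m) :
    rankIn (Finset.range n \ E) m = m - E.card := by
  have : (Finset.range n \ E).filter (· < m) = Finset.range m \ E := by
    ext x
    simp only [Finset.mem_filter, Finset.mem_sdiff, Finset.mem_range]
    constructor
    · exact fun h => ⟨h.2, h.1.2⟩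
    · exact fun h => ⟨⟨h.1.trans_le hm, h.2⟩, h.1⟩
  rw [rankIn, this, Finset.card_sdiff_of_subset hE, Finset.card_range]

/-- Deleting the columns of `E` lowers an index by at most `E.card`. This keeps the points inside
the lengthened rows of an extension. -/
theorem sub_card_le_rankIn {E : Finset ℕ} {n m : ℕ} (hm : m ≤ n) :
    m - E.card ≤ rankIn (Finset.range n \ E) m := by
  have : (Finset.range n \ E).filter (· < m) = Finset.range m \ E := by
    ext x
    simp only [Finset.mem_filter, Finset.mem_sdiff, Finset.mem_range]
    constructor
    · exact fun h => ⟨h.2, h.1.2⟩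
    · exact fun h => ⟨⟨h.1.trans_le hm, h.2⟩, h.1⟩
  rw [rankIn, this]
  have := Finset.le_card_sdiff E (Finset.range m)
  rwa [Finset.card_range] at this

namespace PointedTableau

/-- The length of the last row. -/
def lastRowLen (T : PointedTableau) : ℕ := T.shape.rowLen (T.numRows - 1)

/-- The columns of an extension of `T` by a new row whose point set is `D` that have a point
above the new row. -/
def keptCols (T : PointedTableau) (D : Finset ℕ) : Finset ℕ :=
  Finset.range (T.numCols + (nonMin D).card) \ nonMin D

/-- `T'` is obtained from `T` by inserting empty columns at the positions of the non-minimal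
elements of `D`, and by adding a row of length `m` with point set `D` at the bottom. -/
structure IsRowExt (T : PointedTableau) (m : ℕ) (D : Finset ℕ) (T' : PointedTableau) : Prop where
  shape_lt : ∀ i < T.numRows, ∀ j,
    (i, j) ∈ T'.shape ↔ (i, j - (nonMin D).card) ∈ T.shape
  shape_last : ∀ j, (T.numRows, j) ∈ T'.shape ↔ j < m
  shape_gt : ∀ i, T.numRows < i → ∀ j, (i, j) ∉ T'.shape
  points_lt : ∀ i < T.numRows, ∀ j,
    (i, j) ∈ T'.points ↔ j ∈ T.keptCols D ∧ (i, rankIn (T.keptCols D) j) ∈ T.points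
  points_last : ∀ j, (T.numRows, j) ∈ T'.points ↔ j ∈ D

/-- The condition on `T`, `m` and `D` for an extension to be tree-like. -/
structure RowExtendable (T : PointedTableau) (m : ℕ) (D : Finset ℕ) : Prop where
  treeLike : T.IsTreeLike
  nonempty : D.Nonempty
  subset : D ⊆ Finset.range m
  le : m ≤ T.lastRowLen + (nonMin D).card

theorem IsTreeLike.numRows_pos {T : PointedTableau} (h : T.IsTreeLike) : 0 < T.numRows :=
  lt_numRows (mem_shape_of_mem_points h.root)

theorem IsTreeLike.numCols_pos {T : PointedTableau} (h : T.IsTreeLike) : 0 < T.numCols :=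
  lt_numCols (mem_shape_of_mem_points h.root)

theorem lastRowLen_le_numCols (T : PointedTableau) : T.lastRowLen ≤ T.numCols :=
  T.shape.rowLen_anti _ _ (Nat.zero_le _)

theorem mem_shape_of_lt_lastRowLen {T : PointedTableau} {i j : ℕ} (hi : i < T.numRows)
    (hj : j < T.lastRowLen) : (i, j) ∈ T.shape :=
  mem_shape_of_le (YoungDiagram.mem_iff_lt_rowLen.2 hj) (by omega) le_rfl

theorem lastRowLen_pos {T : PointedTableau} (h : 0 < T.numRows) : 0 < T.lastRowLen :=
  YoungDiagram.mem_iff_lt_rowLen.1 (lt_numRows_iff.1 (by omega))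

theorem RowExtendable.pos {T : PointedTableau} {m : ℕ} {D : Finset ℕ}
    (h : T.RowExtendable m D) : 0 < m := by
  obtain ⟨d, hd⟩ := h.nonempty
  have := Finset.mem_range.1 (h.subset hd)
  omega

theorem RowExtendable.nonMin_subset {T : PointedTableau} {m : ℕ} {D : Finset ℕ}
    (h : T.RowExtendable m D) : nonMin D ⊆ Finset.range m :=
  (_root_.nonMin_subset D).trans h.subset

theorem RowExtendable.le_numCols {T : PointedTableau} {m : ℕ} {D : Finset ℕ}
    (h : T.RowExtendable m D) : m ≤ T.numCols + (nonMin D).card :=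
  h.le.trans (Nat.add_le_add_right T.lastRowLen_le_numCols _)

theorem RowExtendable.nonMin_subset' {T : PointedTableau} {m : ℕ} {D : Finset ℕ}
    (h : T.RowExtendable m D) : nonMin D ⊆ Finset.range (T.numCols + (nonMin D).card) :=
  h.nonMin_subset.trans (Finset.range_subset_range.2 h.le_numCols)

theorem RowExtendable.card_keptCols {T : PointedTableau} {m : ℕ} {D : Finset ℕ}
    (h : T.RowExtendable m D) : (T.keptCols D).card = T.numCols := by
  rw [keptCols, Finset.card_sdiff_of_subset h.nonMin_subset', Finset.card_range]
  omega

theorem mem_keptCols {T : PointedTableau} {D : Finset ℕ} {j : ℕ} :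
    j ∈ T.keptCols D ↔ j < T.numCols + (nonMin D).card ∧ j ∉ nonMin D := by
  simp [keptCols]

section RowExt

variable {T T' : PointedTableau} {m : ℕ} {D : Finset ℕ}

/-- The inserted columns are among the first `m`, and these meet every row of the extension, so each
old row grows by `(nonMin D).card`. In `shape_lt` the truncated subtraction sends small `j` to
column `0`, which is correct because no row of `T` is empty. -/
theorem RowExtendable.exists_ext (h : T.RowExtendable m D) : ∃ T', T.IsRowExt m D T' := by
  obtain ⟨T', h1, h2⟩ := exists_of_mem
    (fun i j => (i < T.numRows ∧ (i, j - (nonMin D).card) ∈ T.shape) ∨ (i = T.numRows ∧ j < m))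
    (fun i j => (i < T.numRows ∧ j ∈ T.keptCols D ∧ (i, rankIn (T.keptCols D) j) ∈ T.points) ∨
      (i = T.numRows ∧ j ∈ D))
    (T.numRows + T.numCols + (nonMin D).card + m + 1)
    (by
      rintro i j (⟨h1, h2⟩ | ⟨h1, h2⟩)
      · have := lt_numCols h2
        omega
      · omega)
    (by
      rintro i j i' j' (⟨h1, h2⟩ | ⟨h1, h2⟩) hi hj
      · exact Or.inl ⟨by omega, mem_shape_of_le h2 hi (by omega)⟩
      · rcases hi.eq_or_lt with hi | hi
        · exact Or.inr ⟨by omega, by omega⟩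
        · have := lastRowLen_pos h.treeLike.numRows_pos
          have := h.le
          exact Or.inl ⟨by omega, mem_shape_of_lt_lastRowLen (by omega) (by omega)⟩)
    (by
      rintro i j (⟨h1, h2, h3⟩ | ⟨h1, h2⟩)
      · exact Or.inl ⟨h1, mem_shape_of_le (mem_shape_of_mem_points h3) le_rfl
          (sub_card_le_rankIn (mem_keptCols.1 h2).1.le)⟩
      · exact Or.inr ⟨h1, Finset.mem_range.1 (h.subset h2)⟩)
  refine ⟨T', ⟨fun i hi j => ?_, fun j => ?_, fun i hi j => ?_, fun i hi j => ?_, fun j => ?_⟩⟩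
  · rw [h1]; simp [hi, hi.ne]
  · rw [h1]; simp
  · rw [h1]; simp [hi.not_gt, hi.ne']
  · rw [h2]; simp [hi, hi.ne]
  · rw [h2]; simp

theorem IsRowExt.numRows_eq (h : T.IsRowExt m D T') (hT : T.RowExtendable m D) :
    T'.numRows = T.numRows + 1 :=
  PointedTableau.numRows_eq fun i => by
    rcases Nat.lt_trichotomy i T.numRows with hi | hi | hi
    · rw [h.shape_lt i hi, Nat.zero_sub, ← lt_numRows_iff]; omega
    · subst hi
      rw [h.shape_last]
      have := hT.pos
      omega
    · exact iff_of_false (h.shape_gt i hi 0) (by omega)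

theorem IsRowExt.numCols_eq (h : T.IsRowExt m D T') (hT : T.RowExtendable m D) :
    T'.numCols = T.numCols + (nonMin D).card :=
  PointedTableau.numCols_eq fun j => by
    have := hT.treeLike.numCols_pos
    rw [h.shape_lt 0 hT.treeLike.numRows_pos, ← lt_numCols_iff]; omega

theorem IsRowExt.lastRowLen_eq (h : T.IsRowExt m D T') (hT : T.RowExtendable m D) :
    T'.lastRowLen = m := by
  have key : ∀ j, j < T'.lastRowLen ↔ j < m := fun j => by
    rw [← h.shape_last, lastRowLen, h.numRows_eq hT]
    exact YoungDiagram.mem_iff_lt_rowLen.symm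
  have h1 := key m
  have h2 := key T'.lastRowLen
  omega

/-- The new row is not the first one, and the inserted columns have no point above it. Invariance of
this statistic is what lets the weights `x ^ T.firstRowPoints` pass through the recursion. -/
theorem IsRowExt.firstRowPoints_eq (h : T.IsRowExt m D T') (hT : T.RowExtendable m D) :
    T'.firstRowPoints = T.firstRowPoints := by
  have hr := hT.treeLike.numRows_pos
  refine Finset.card_bij (fun p _ => (0, rankIn (T.keptCols D) p.2)) ?_ ?_ ?_
  · rintro ⟨i, j⟩ hp
    obtain ⟨hp, h0⟩ := Finset.mem_filter.1 hp
    simp only at h0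
    subst h0
    exact Finset.mem_filter.2 ⟨((h.points_lt _ hr _).1 hp).2, rfl⟩
  · rintro ⟨i, j⟩ hp ⟨i', j'⟩ hp' heq
    obtain ⟨hp, h0⟩ := Finset.mem_filter.1 hp
    obtain ⟨hp', h0'⟩ := Finset.mem_filter.1 hp'
    simp only at h0 h0'
    subst h0 h0'
    rw [rankIn_injOn _ ((h.points_lt _ hr _).1 hp).1 ((h.points_lt _ hr _).1 hp').1
      (congrArg Prod.snd heq)]
  · rintro ⟨i, j⟩ hp
    obtain ⟨hp, h0⟩ := Finset.mem_filter.1 hp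
    simp only at h0
    subst h0
    obtain ⟨j, hj, rfl⟩ := exists_rankIn_eq
      (hT.card_keptCols ▸ lt_numCols (mem_shape_of_mem_points hp) : j < (T.keptCols D).card)
    exact ⟨(0, j), Finset.mem_filter.2 ⟨(h.points_lt _ hr _).2 ⟨hj, hp⟩, rfl⟩, rfl⟩

/-- The least element `c` of `D` lies in an old column, so it has a point above and none to its
left. The other elements of `D` lie in columns that are empty above, with `c` to their left. Older
points keep their parent conditions, since only empty columns were inserted among them. -/
theorem IsRowExt.isTreeLike (h : T.IsRowExt m D T') (hT : T.RowExtendable m D) :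
    T'.IsTreeLike := by
  obtain ⟨c, hc, hD, hlt⟩ := exists_eq_insert_nonMin hT.nonempty
  have hr := hT.treeLike.numRows_pos
  have hcD : c ∈ D := by rw [hD]; exact Finset.mem_insert_self _ _
  have hcm : c < m := Finset.mem_range.1 (hT.subset hcD)
  have hcK : c ∈ T.keptCols D := mem_keptCols.2 ⟨hcm.trans_le hT.le_numCols, hc⟩
  have hcol : ∀ j ∈ T.keptCols D, ∃ i < T.numRows, (i, j) ∈ T'.points := by
    intro j hj
    obtain ⟨i, hi⟩ := hT.treeLike.col _ (hT.card_keptCols ▸ rankIn_lt_card hj)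
    have hi' := lt_numRows (mem_shape_of_mem_points hi)
    exact ⟨i, hi', (h.points_lt i hi' j).2 ⟨hj, hi⟩⟩
  have hpt : ∀ {i j}, (i, j) ∈ T'.points → i ≤ T.numRows := by
    intro i j hp
    by_contra h'
    exact h.shape_gt i (not_le.1 h') j (mem_shape_of_mem_points hp)
  have h0K : 0 ∈ T.keptCols D :=
    mem_keptCols.2 ⟨by have := hT.treeLike.numCols_pos; omega, zero_notMem_nonMin D⟩
  refine ⟨?_, ?_, ?_, ?_⟩
  · exact (h.points_lt 0 hr 0).2 ⟨h0K, by rw [rankIn_zero]; exact hT.treeLike.root⟩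
  · intro i j hp hne
    rcases (hpt hp).eq_or_lt with hi | hi
    · subst hi
      have hj := (h.points_last j).1 hp
      by_cases hjE : j ∈ nonMin D
      · refine ⟨Or.inr ⟨c, hlt j hjE, (h.points_last c).2 hcD⟩, ?_⟩
        rintro ⟨⟨i, hi, hp'⟩, -⟩
        exact (mem_keptCols.1 ((h.points_lt i hi j).1 hp').1).2 hjE
      · have hjc : j = c := by
          rw [hD, Finset.mem_insert] at hj
          exact hj.resolve_right hjE
        subst hjc
        refine ⟨Or.inl (hcol j hcK), ?_⟩
        rintro ⟨-, j', hj', hp'⟩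
        have hj'' := (h.points_last j').1 hp'
        rw [hD, Finset.mem_insert] at hj''
        rcases hj'' with hj'' | hj''
        · omega
        · exact (hlt j' hj'').not_gt hj'
    · obtain ⟨hjK, hjp⟩ := (h.points_lt i hi j).1 hp
      have ha : (∃ i' < i, (i', j) ∈ T'.points) ↔
          ∃ i' < i, (i', rankIn (T.keptCols D) j) ∈ T.points := by
        refine exists_congr fun i' => and_congr_right fun hi' => ?_
        rw [h.points_lt i' (hi'.trans hi)]
        exact and_iff_right hjK
      have hl : (∃ j' < j, (i, j') ∈ T'.points) ↔
          ∃ j' < rankIn (T.keptCols D) j, (i, j') ∈ T.points := by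
        constructor
        · rintro ⟨j', hj', hp'⟩
          obtain ⟨h1, h2⟩ := (h.points_lt i hi j').1 hp'
          exact ⟨_, rankIn_lt_rankIn h1 hj', h2⟩
        · rintro ⟨k, hk, hp'⟩
          obtain ⟨j', hj', rfl⟩ := exists_rankIn_eq
            (hT.card_keptCols ▸ lt_numCols (mem_shape_of_mem_points hp') :
              k < (T.keptCols D).card)
          exact ⟨j', (rankIn_lt_iff hj').1 hk, (h.points_lt i hi j').2 ⟨hj', hp'⟩⟩
      rw [ha, hl]
      refine hT.treeLike.parent _ _ hjp fun h0 => hne ?_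
      rw [Prod.mk.injEq] at h0
      rw [h0.1, eq_zero_of_rankIn_eq_zero h0K h0.2]
  · intro i hi
    rw [h.numRows_eq hT] at hi
    rcases (Nat.lt_succ_iff.1 hi).eq_or_lt with hi | hi
    · subst hi
      exact ⟨c, (h.points_last c).2 hcD⟩
    · obtain ⟨k, hk⟩ := hT.treeLike.row i hi
      obtain ⟨j', hj', rfl⟩ := exists_rankIn_eq
        (hT.card_keptCols ▸ lt_numCols (mem_shape_of_mem_points hk) : k < (T.keptCols D).card)
      exact ⟨j', (h.points_lt i hi j').2 ⟨hj', hk⟩⟩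
  · intro j hj
    rw [h.numCols_eq hT] at hj
    by_cases hjE : j ∈ nonMin D
    · exact ⟨_, (h.points_last j).2 (nonMin_subset D hjE)⟩
    · obtain ⟨i, -, hi⟩ := hcol j (mem_keptCols.2 ⟨hj, hjE⟩)
      exact ⟨i, hi⟩

theorem IsRowExt.size_eq (h : T.IsRowExt m D T') (hT : T.RowExtendable m D) :
    T'.size = T.size + D.card := by
  have h1 := (h.isTreeLike hT).size_add_one
  have h2 := hT.treeLike.size_add_one
  rw [h.numRows_eq hT, h.numCols_eq hT] at h1
  have h3 := card_nonMin hT.nonempty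
  omega

theorem IsRowExt.right_unique {T₁ T₂ : PointedTableau} (h₁ : T.IsRowExt m D T₁)
    (h₂ : T.IsRowExt m D T₂) : T₁ = T₂ := by
  refine ext_mem (fun i j => ?_) (fun i j => ?_)
  · rcases Nat.lt_trichotomy i T.numRows with hi | hi | hi
    · rw [h₁.shape_lt i hi, h₂.shape_lt i hi]
    · rw [hi, h₁.shape_last, h₂.shape_last]
    · exact iff_of_false (h₁.shape_gt i hi j) (h₂.shape_gt i hi j)
  · rcases Nat.lt_trichotomy i T.numRows with hi | hi | hi
    · rw [h₁.points_lt i hi, h₂.points_lt i hi]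
    · rw [hi, h₁.points_last, h₂.points_last]
    · exact iff_of_false (fun h => h₁.shape_gt i hi j (mem_shape_of_mem_points h))
        (fun h => h₂.shape_gt i hi j (mem_shape_of_mem_points h))

theorem IsRowExt.left_unique {T₁ T₂ : PointedTableau} {D₁ D₂ : Finset ℕ}
    (h₁ : T₁.IsRowExt m D₁ T') (h₂ : T₂.IsRowExt m D₂ T') (hT₁ : T₁.RowExtendable m D₁)
    (hT₂ : T₂.RowExtendable m D₂) : D₁ = D₂ ∧ T₁ = T₂ := by
  have hr : T₁.numRows = T₂.numRows := by
    have := (h₁.numRows_eq hT₁).symm.trans (h₂.numRows_eq hT₂)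
    omega
  have hD : D₁ = D₂ := by
    ext j
    rw [← h₁.points_last, ← h₂.points_last, hr]
  subst hD
  have hw : T₁.numCols = T₂.numCols := by
    have := (h₁.numCols_eq hT₁).symm.trans (h₂.numCols_eq hT₂)
    omega
  have hK : T₁.keptCols D₁ = T₂.keptCols D₁ := by rw [keptCols, keptCols, hw]
  refine ⟨rfl, ext_mem (fun i j => ?_) (fun i j => ?_)⟩
  · rcases Nat.lt_or_ge i T₁.numRows with hi | hi
    · have h3 := h₁.shape_lt i hi (j + (nonMin D₁).card)
      have h4 := h₂.shape_lt i (hr ▸ hi) (j + (nonMin D₁).card)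
      rw [Nat.add_sub_cancel] at h3 h4
      exact h3.symm.trans h4
    · exact iff_of_false (fun h => (lt_numRows h).not_ge hi)
        (fun h => (lt_numRows h).not_ge (hr ▸ hi))
  · rcases Nat.lt_or_ge i T₁.numRows with hi | hi
    · rcases Nat.lt_or_ge j T₁.numCols with hj | hj
      · obtain ⟨j', hj', rfl⟩ := exists_rankIn_eq (hT₁.card_keptCols ▸ hj)
        have h3 := h₁.points_lt i hi j'
        have h4 := h₂.points_lt i (hr ▸ hi) j'
        rw [and_iff_right hj'] at h3
        rw [← hK, and_iff_right hj'] at h4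
        exact h3.symm.trans h4
      · exact iff_of_false (fun h => (lt_numCols (mem_shape_of_mem_points h)).not_ge hj)
          (fun h => (lt_numCols (mem_shape_of_mem_points h)).not_ge (hw ▸ hj))
    · exact iff_of_false (fun h => (lt_numRows (mem_shape_of_mem_points h)).not_ge hi)
        (fun h => (lt_numRows (mem_shape_of_mem_points h)).not_ge (hr ▸ hi))

/-- Every point of the last row other than the leftmost one has a point to its left, hence none
above, so it is alone in its column. Removing the row together with these columns leaves a tree-like
tableau; the leftmost point does have a point above, so its column remains nonempty. -/
theorem IsTreeLike.exists_isRowExt (h : T'.IsTreeLike) (h2 : 2 ≤ T'.numRows) :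
    ∃ (D : Finset ℕ) (T : PointedTableau),
      T.RowExtendable T'.lastRowLen D ∧ T.IsRowExt T'.lastRowLen D T' := by
  classical
  obtain ⟨r, hr⟩ : ∃ r, T'.numRows = r + 1 := ⟨T'.numRows - 1, by omega⟩
  set m := T'.lastRowLen with hm
  have hmw : m ≤ T'.numCols := T'.lastRowLen_le_numCols
  have hlast : ∀ j, (r, j) ∈ T'.shape ↔ j < m := fun j => by
    rw [hm, lastRowLen, hr]; exact YoungDiagram.mem_iff_lt_rowLen
  set D := (Finset.range m).filter fun j => (r, j) ∈ T'.points with hDdef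
  have hmemD : ∀ j, j ∈ D ↔ (r, j) ∈ T'.points := fun j => by
    rw [hDdef, Finset.mem_filter, Finset.mem_range, ← hlast]
    exact and_iff_right_of_imp mem_shape_of_mem_points
  have hDne : D.Nonempty := by
    obtain ⟨j, hj⟩ := h.row r (by omega)
    exact ⟨j, (hmemD j).2 hj⟩
  have hDm : D ⊆ Finset.range m := Finset.filter_subset _ _
  obtain ⟨c, hc, hD, hlt⟩ := exists_eq_insert_nonMin hDne
  have hcD : c ∈ D := by rw [hD]; exact Finset.mem_insert_self _ _
  set E := nonMin D with hE
  have hED : E ⊆ D := nonMin_subset D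
  have hEm : E ⊆ Finset.range m := hED.trans hDm
  have hEw : E ⊆ Finset.range T'.numCols := hEm.trans (Finset.range_subset_range.2 hmw)
  have hEc : E.card < m := by
    have h1 := Finset.card_le_card hDm
    rw [Finset.card_range] at h1
    have h2 : E.card + 1 = D.card := card_nonMin hDne
    omega
  have hne : ∀ j, (r, j) ≠ (0, 0) := fun j h => by
    rw [Prod.mk.injEq] at h
    omega
  have hEabove : ∀ i < r, ∀ j ∈ E, (i, j) ∉ T'.points := by
    intro i hi j hj hp
    exact (h.parent r j ((hmemD j).1 (hED hj)) (hne j)).2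
      ⟨⟨i, hi, hp⟩, c, hlt j hj, (hmemD c).1 hcD⟩
  have hcabove : ∃ i < r, (i, c) ∈ T'.points := by
    refine (h.parent r c ((hmemD c).1 hcD) (hne c)).1.resolve_right ?_
    rintro ⟨j, hj, hp⟩
    have hjD := (hmemD j).2 hp
    rw [hD, Finset.mem_insert] at hjD
    rcases hjD with hjD | hjD
    · omega
    · exact (hlt j hjD).not_gt hj
  set K := Finset.range T'.numCols \ E with hK
  have hmemK : ∀ j, j ∈ K ↔ j < T'.numCols ∧ j ∉ E := fun j => by simp [hK]
  have hKcard : K.card = T'.numCols - E.card := by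
    rw [hK, Finset.card_sdiff_of_subset hEw, Finset.card_range]
  have hptK : ∀ i < r, ∀ j, (i, j) ∈ T'.points → j ∈ K := fun i hi j hp =>
    (hmemK j).2 ⟨lt_numCols (mem_shape_of_mem_points hp), fun hj => hEabove i hi j hj hp⟩
  have hcolK : ∀ j ∈ K, ∃ i < r, (i, j) ∈ T'.points := by
    intro j hj
    obtain ⟨i, hi⟩ := h.col j ((hmemK j).1 hj).1
    have hir := lt_numRows (mem_shape_of_mem_points hi)
    rcases Nat.lt_or_ge i r with hi' | hi'
    · exact ⟨i, hi', hi⟩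
    · have : i = r := by omega
      subst this
      have hjD := (hmemD j).2 hi
      rw [hD, Finset.mem_insert] at hjD
      exact hjD.resolve_right ((hmemK j).1 hj).2 ▸ hcabove
  obtain ⟨T, hs, hp⟩ := exists_of_mem
    (fun i j => i < r ∧ (i, j + E.card) ∈ T'.shape)
    (fun i j => i < r ∧ ∃ j' ∈ K, rankIn K j' = j ∧ (i, j') ∈ T'.points)
    (r + T'.numCols)
    (by
      rintro i j ⟨h1, h2⟩
      have := lt_numCols h2
      omega)
    (by
      rintro i j i' j' ⟨h1, h2⟩ hi hj
      exact ⟨by omega, mem_shape_of_le h2 hi (by omega)⟩)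
    (by
      rintro i _ ⟨h1, j, hj, rfl, h2⟩
      refine ⟨h1, ?_⟩
      set L := T'.shape.rowLen i with hL
      have hmL : m ≤ L := T'.shape.rowLen_anti i (T'.numRows - 1) (by omega)
      have hLw : L ≤ T'.numCols := T'.shape.rowLen_anti 0 i (Nat.zero_le _)
      have hjL : j < L := YoungDiagram.mem_iff_lt_rowLen.1 (mem_shape_of_mem_points h2)
      -- All deleted columns are among the first `m ≤ L`, so a row of length `L` loses exactly
      -- `E.card` cells and its remaining points stay inside.
      have h3 := rankIn_lt_rankIn hj hjL
      rw [hK, rankIn_range_sdiff hLw (hEm.trans (Finset.range_subset_range.2 hmL)), ← hK] at h3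
      exact YoungDiagram.mem_iff_lt_rowLen.2 (by omega))
  have hTr : T.numRows = r := PointedTableau.numRows_eq fun i => by
    rw [hs, and_iff_left_iff_imp, Nat.zero_add]
    intro hi
    exact mem_shape_of_lt_lastRowLen (by omega) hEc
  have hTw : T.numCols = T'.numCols - E.card := PointedTableau.numCols_eq fun j => by
    rw [hs, ← lt_numCols_iff]
    omega
  have hTK : T.keptCols D = K := by
    rw [keptCols, hTw, ← hE, Nat.sub_add_cancel (by omega)]
  have hpK : ∀ i < r, ∀ j ∈ K, ((i, rankIn K j) ∈ T.points ↔ (i, j) ∈ T'.points) := by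
    intro i hi j hj
    rw [hp]
    constructor
    · rintro ⟨-, j', hj', heq, h'⟩
      rwa [← rankIn_injOn K hj' hj heq]
    · exact fun h' => ⟨hi, j, hj, rfl, h'⟩
  have hK0 : 0 ∈ K := hptK 0 (by omega) 0 h.root
  have htree : T.IsTreeLike := by
    refine ⟨(hp 0 0).2 ⟨by omega, 0, hK0, rankIn_zero K, h.root⟩, ?_, ?_, ?_⟩
    · intro i j hij hne
      obtain ⟨hi, j, hj, rfl, hp'⟩ := (hp i j).1 hij
      have ha : (∃ i' < i, (i', rankIn K j) ∈ T.points) ↔ ∃ i' < i, (i', j) ∈ T'.points :=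
        exists_congr fun i' => and_congr_right fun hi' => hpK i' (hi'.trans hi) j hj
      have hl : (∃ j' < rankIn K j, (i, j') ∈ T.points) ↔ ∃ j' < j, (i, j') ∈ T'.points := by
        constructor
        · rintro ⟨k, hk, hpk⟩
          obtain ⟨-, j', hj', rfl, hp''⟩ := (hp i k).1 hpk
          exact ⟨j', (rankIn_lt_iff hj').1 hk, hp''⟩
        · rintro ⟨j', hj', hp''⟩
          have := hptK i hi j' hp''
          exact ⟨_, rankIn_lt_rankIn this hj', (hpK i hi j' this).2 hp''⟩
      rw [ha, hl]
      refine h.parent i j hp' fun h0 => hne ?_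
      rw [Prod.mk.injEq] at h0
      rw [h0.1, h0.2, rankIn_zero]
    · intro i hi
      rw [hTr] at hi
      obtain ⟨j, hj⟩ := h.row i (by omega)
      exact ⟨_, (hpK i hi j (hptK i hi j hj)).2 hj⟩
    · intro k hk
      rw [hTw, ← hKcard] at hk
      obtain ⟨j, hj, rfl⟩ := exists_rankIn_eq hk
      obtain ⟨i, hi, hp'⟩ := hcolK j hj
      exact ⟨i, (hpK i hi j hj).2 hp'⟩
  refine ⟨D, T, ⟨htree, hDne, hDm, ?_⟩, ?_, ?_, ?_, ?_, ?_⟩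
  · have h3 : m - E.card ≤ T.lastRowLen := by
      by_contra h'
      refine (lt_irrefl T.lastRowLen) (YoungDiagram.mem_iff_lt_rowLen.1 ((hs _ _).2 ⟨?_, ?_⟩))
      · rw [hTr]; omega
      · refine mem_shape_of_lt_lastRowLen (by omega) ?_
        omega
    rw [← hE]
    omega
  · rw [hTr]
    intro i hi j
    rw [hs, and_iff_right hi]
    rcases Nat.lt_or_ge j E.card with hj | hj
    · refine iff_of_true (mem_shape_of_lt_lastRowLen (by omega) (by omega))
        (mem_shape_of_lt_lastRowLen (by omega) ?_)
      rw [← hE]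
      omega
    · rw [Nat.sub_add_cancel hj]
  · rw [hTr]; exact hlast
  · rw [hTr]
    intro i hi j h'
    have := lt_numRows h'
    omega
  · rw [hTr, hTK]
    intro i hi j
    constructor
    · intro h'
      have := hptK i hi j h'
      exact ⟨this, (hpK i hi j this).2 h'⟩
    · rintro ⟨h1, h2⟩
      exact (hpK i hi j h1).1 h2
  · rw [hTr]
    exact fun j => (hmemD j).symm

end RowExt

end PointedTableau

/-! ### Counting tableaux and non-ambiguous trees by removing the last row -/

namespace PointedTableau

theorem finite_setOf_numRows_numCols_le (N : ℕ) :
    {T : PointedTableau | T.numRows ≤ N ∧ T.numCols ≤ N}.Finite := by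
  let B := (Finset.range N ×ˢ Finset.range N).powerset
  refine Set.Finite.of_injOn (f := fun T : PointedTableau => (T.shape.cells, T.points))
    (t := (B ×ˢ B : Finset _)) ?_ ?_ (Finset.finite_toSet _)
  · rintro T ⟨h1, h2⟩
    have h : T.shape.cells ⊆ Finset.range N ×ˢ Finset.range N := by
      rintro ⟨i, j⟩ hij
      have h3 := lt_numRows hij
      have h4 := lt_numCols hij
      simp only [Finset.mem_product, Finset.mem_range]
      omega
    simp only [Finset.coe_product, Set.mem_prod, Finset.mem_coe, B, Finset.mem_powerset]
    exact ⟨h, T.points_subset.trans h⟩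
  · intro T _ T' _ h
    simp only [Prod.mk.injEq] at h
    exact PointedTableau.ext (YoungDiagram.ext h.1) h.2

theorem finite_setOf_isTreeLike (n : ℕ) :
    {T : PointedTableau | T.IsTreeLike ∧ T.size = n}.Finite := by
  refine (finite_setOf_numRows_numCols_le (n + 1)).subset ?_
  rintro T ⟨h1, h2⟩
  have := h1.size_add_one
  have := h1.numRows_pos
  have := h1.numCols_pos
  exact ⟨by omega, by omega⟩

theorem isNonAmbiguousTree_iff {T : PointedTableau} {h w : ℕ} :
    T.IsNonAmbiguousTree h w ↔
      T.IsTreeLike ∧ T.numRows = h + 1 ∧ T.numCols = w + 1 ∧ T.lastRowLen = w + 1 := by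
  constructor
  · intro hT
    have h1 : T.numRows = h + 1 := numRows_eq fun i => by rw [hT.mem_shape]; omega
    refine ⟨hT.1, h1, numCols_eq fun j => by rw [hT.mem_shape]; omega, ?_⟩
    have key : ∀ j, j < T.lastRowLen ↔ j < w + 1 := fun j => by
      rw [lastRowLen, ← YoungDiagram.mem_iff_lt_rowLen, hT.mem_shape]
      omega
    have h2 := key T.lastRowLen
    have h3 := key (w + 1)
    omega
  · rintro ⟨hT, h1, h2, h3⟩
    refine ⟨hT, ?_⟩
    ext ⟨i, j⟩
    simp only [Finset.mem_product, Finset.mem_range]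
    constructor
    · intro hij
      exact ⟨h1 ▸ lt_numRows hij, h2 ▸ lt_numCols hij⟩
    · rintro ⟨hi, hj⟩
      exact mem_shape_of_lt_lastRowLen (h1.symm ▸ hi) (h3.symm ▸ hj)

theorem finite_setOf_isNonAmbiguousTree (h w : ℕ) :
    {T : PointedTableau | T.IsNonAmbiguousTree h w}.Finite := by
  refine (finite_setOf_numRows_numCols_le (h + w + 1)).subset ?_
  intro T hT
  obtain ⟨-, h1, h2, -⟩ := isNonAmbiguousTree_iff.1 hT
  exact ⟨by omega, by omega⟩

/-- The tree-like tableaux of size `n` whose last row has length at least `m`. -/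
noncomputable def treeLikeFinset (n m : ℕ) : Finset PointedTableau :=
  ((finite_setOf_isTreeLike n).subset (t := {T | (T.IsTreeLike ∧ T.size = n) ∧ m ≤ T.lastRowLen})
    fun _ h => h.1).toFinset

theorem mem_treeLikeFinset {n m : ℕ} {T : PointedTableau} :
    T ∈ treeLikeFinset n m ↔ (T.IsTreeLike ∧ T.size = n) ∧ m ≤ T.lastRowLen := by
  simp [treeLikeFinset]

/-- The non-ambiguous trees of height `h` and width `w`. -/
noncomputable def nonAmbiguousTreeFinset (h w : ℕ) : Finset PointedTableau :=
  (finite_setOf_isNonAmbiguousTree h w).toFinset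

theorem mem_nonAmbiguousTreeFinset {h w : ℕ} {T : PointedTableau} :
    T ∈ nonAmbiguousTreeFinset h w ↔ T.IsNonAmbiguousTree h w := by
  simp [nonAmbiguousTreeFinset]

/-- Summation over tree-like tableaux by removing the last row. -/
theorem sum_eq_sum_rowExt {M : Type*} [AddCommMonoid M] (m : ℕ) (A : Finset PointedTableau)
    (B : Finset ℕ → Finset PointedTableau) (g : ℕ → M)
    (hA : ∀ T' ∈ A, T'.IsTreeLike ∧ 2 ≤ T'.numRows ∧ T'.lastRowLen = m)
    (hB : ∀ D ⊆ Finset.range m, D.Nonempty → ∀ T ∈ B D, T.RowExtendable m D)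
    (hAB : ∀ D T T', T.RowExtendable m D → T.IsRowExt m D T' → (T' ∈ A ↔ T ∈ B D)) :
    ∑ T' ∈ A, g T'.firstRowPoints =
      ∑ D ∈ (Finset.range m).powerset.erase ∅, ∑ T ∈ B D, g T.firstRowPoints := by
  have hext : ∀ x ∈ ((Finset.range m).powerset.erase ∅).sigma B, x.2.RowExtendable m x.1 := by
    rintro ⟨D, T⟩ hx
    obtain ⟨hD, hT⟩ := Finset.mem_sigma.1 hx
    obtain ⟨h1, h2⟩ := Finset.mem_erase.1 hD
    exact hB D (Finset.mem_powerset.1 h2) (Finset.nonempty_iff_ne_empty.2 h1) T hT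
  rw [Finset.sum_sigma']
  symm
  refine Finset.sum_bij (fun x hx => (hext x hx).exists_ext.choose) ?_ ?_ ?_ ?_
  · intro x hx
    exact (hAB _ _ _ (hext x hx) (hext x hx).exists_ext.choose_spec).2 (Finset.mem_sigma.1 hx).2
  · intro x hx y hy h
    have h1 := (hext x hx).exists_ext.choose_spec
    have h2 := (hext y hy).exists_ext.choose_spec
    rw [← h] at h2
    obtain ⟨h3, h4⟩ := h1.left_unique h2 (hext x hx) (hext y hy)
    exact Sigma.ext h3 (heq_of_eq h4)
  · intro T' hT'
    obtain ⟨h1, h2, h3⟩ := hA T' hT'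
    obtain ⟨D, T, hT, hTT'⟩ := h1.exists_isRowExt h2
    rw [h3] at hT hTT'
    have hx : (⟨D, T⟩ : (_ : Finset ℕ) × PointedTableau) ∈
        ((Finset.range m).powerset.erase ∅).sigma B := by
      refine Finset.mem_sigma.2 ⟨Finset.mem_erase.2 ⟨hT.nonempty.ne_empty,
        Finset.mem_powerset.2 hT.subset⟩, (hAB _ _ _ hT hTT').1 hT'⟩
    exact ⟨_, hx, (hext _ hx).exists_ext.choose_spec.right_unique hTT'⟩
  · intro x hx
    rw [(hext x hx).exists_ext.choose_spec.firstRowPoints_eq (hext x hx)]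

theorem sum_powerset_erase_empty {M : Type*} [AddCommGroup M] (m : ℕ) (f : ℕ → M) :
    ∑ D ∈ (Finset.range m).powerset.erase ∅, f D.card =
      ∑ k ∈ Finset.range m, m.choose (k + 1) • f (k + 1) := by
  have h1 := Finset.add_sum_erase (Finset.range m).powerset (fun D => f D.card)
    (Finset.empty_mem_powerset _)
  rw [Finset.sum_powerset_apply_card, Finset.card_range, Finset.sum_range_succ'] at h1
  simp only [Finset.card_empty, Nat.choose_zero_right, one_smul] at h1
  rw [add_comm] at h1
  exact add_right_cancel h1

/-- Size `m` with at least `m` columns leaves room, by the size formula, for one row only, and then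
all its cells are pointed. -/
theorem sum_treeLikeFinset_self {R : Type*} [CommRing R] (x : R) (m : ℕ) (hm : 0 < m) :
    ∑ T ∈ treeLikeFinset m m, x ^ T.firstRowPoints = x ^ m := by
  obtain ⟨T, h1, h2⟩ := exists_of_mem (fun i j => i = 0 ∧ j < m) (fun i j => i = 0 ∧ j < m) m
    (by omega) (by omega) (fun _ _ => id)
  have hr : T.numRows = 1 := numRows_eq fun i => by rw [h1]; omega
  have hc : T.numCols = m := numCols_eq fun j => by rw [h1]; omega
  have hT : T.IsTreeLike := by
    refine ⟨(h2 0 0).2 ⟨rfl, hm⟩, fun i j hij hne => ?_, fun i hi => ?_, fun j hj => ?_⟩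
    · obtain ⟨rfl, hj⟩ := (h2 i j).1 hij
      refine ⟨Or.inr ⟨0, ?_, (h2 0 0).2 ⟨rfl, hm⟩⟩, ?_⟩
      · rw [ne_eq, Prod.mk.injEq] at hne
        omega
      · rintro ⟨⟨i, hi, -⟩, -⟩
        omega
    · exact ⟨0, (h2 i 0).2 ⟨by omega, hm⟩⟩
    · exact ⟨0, (h2 0 j).2 ⟨rfl, by omega⟩⟩
  have hmem : T ∈ treeLikeFinset m m := by
    refine mem_treeLikeFinset.2 ⟨⟨hT, ?_⟩, ?_⟩
    · have := hT.size_add_one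
      omega
    · rw [lastRowLen, hr]
      exact hc.ge
  have hsing : treeLikeFinset m m = {T} := by
    refine Finset.eq_singleton_iff_unique_mem.2 ⟨hmem, fun T' hT' => ?_⟩
    obtain ⟨⟨hT', hs⟩, hl⟩ := mem_treeLikeFinset.1 hT'
    have h3 := hT'.size_add_one
    have h4 := T'.lastRowLen_le_numCols
    have h5 := hT'.numRows_pos
    have hr' : T'.numRows = 1 := by omega
    have hc' : T'.numCols = m := by omega
    have hsh : ∀ i j, (i, j) ∈ T'.shape ↔ i = 0 ∧ j < m := by
      intro i j
      constructor
      · intro h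
        have := lt_numRows h
        have := lt_numCols h
        omega
      · rintro ⟨rfl, hj⟩
        exact lt_numCols_iff.1 (hc'.symm ▸ hj)
    refine ext_mem (fun i j => by rw [h1, hsh]) fun i j => ?_
    rw [h2]
    constructor
    · exact fun h => (hsh i j).1 (mem_shape_of_mem_points h)
    · rintro ⟨rfl, hj⟩
      obtain ⟨i, hi⟩ := hT'.col j (by omega)
      have := ((hsh i j).1 (mem_shape_of_mem_points hi)).1
      rwa [this] at hi
  have hfrp : T.firstRowPoints = m := by
    rw [firstRowPoints_eq_card, hc, Finset.filter_true_of_mem, Finset.card_range]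
    intro j hj
    exact (h2 0 j).2 ⟨rfl, Finset.mem_range.1 hj⟩
  rw [hsing, Finset.sum_singleton, hfrp]

/-- Either the last row is longer than `m`, or it has length exactly `m` and is removed. If it holds
`k + 1` points, then `k` columns go with it, so the preceding row keeps a length of at least `m -
k`. As `m < n`, a last row of length `m` cannot be the only row. -/
theorem sum_treeLikeFinset_step {R : Type*} [CommRing R] (x : R) {n m : ℕ} (hmn : m < n) :
    ∑ T ∈ treeLikeFinset n m, x ^ T.firstRowPoints =
      ∑ T ∈ treeLikeFinset n (m + 1), x ^ T.firstRowPoints +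
        ∑ k ∈ Finset.range m, m.choose (k + 1) •
          ∑ T ∈ treeLikeFinset (n - (k + 1)) (m - k), x ^ T.firstRowPoints := by
  classical
  rw [← Finset.sum_filter_add_sum_filter_not (treeLikeFinset n m) (fun T => m + 1 ≤ T.lastRowLen)]
  congr 1
  · refine Finset.sum_congr ?_ fun _ _ => rfl
    ext T
    rw [Finset.mem_filter, mem_treeLikeFinset, mem_treeLikeFinset]
    constructor
    · exact fun h => ⟨h.1.1, h.2⟩
    · exact fun h => ⟨⟨h.1, by omega⟩, h.2⟩
  · rw [sum_eq_sum_rowExt m _ (fun D => treeLikeFinset (n - D.card) (m + 1 - D.card)) (x ^ ·),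
      sum_powerset_erase_empty m
        (fun k => ∑ T ∈ treeLikeFinset (n - k) (m + 1 - k), x ^ T.firstRowPoints)]
    · simp only [Nat.add_sub_add_right]
    · intro T hT
      obtain ⟨hT, hl⟩ := Finset.mem_filter.1 hT
      obtain ⟨⟨hT, hs⟩, hl'⟩ := mem_treeLikeFinset.1 hT
      refine ⟨hT, ?_, by omega⟩
      by_contra h
      have h1 : T.numRows = 1 := by
        have := hT.numRows_pos
        omega
      have h2 : T.lastRowLen = T.numCols := by rw [lastRowLen, h1]; rfl
      have := hT.size_add_one
      omega
    · intro D hD hne T hT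
      obtain ⟨⟨hT, -⟩, hl⟩ := mem_treeLikeFinset.1 hT
      have := card_nonMin hne
      exact ⟨hT, hne, hD, by omega⟩
    · intro D T T' hT hTT'
      have h1 := card_nonMin hT.nonempty
      have h2 := Finset.card_le_card hT.subset
      rw [Finset.card_range] at h2
      have h3 := hT.le
      rw [Finset.mem_filter, mem_treeLikeFinset, mem_treeLikeFinset, hTT'.lastRowLen_eq hT,
        hTT'.size_eq hT]
      constructor
      · exact fun h => ⟨⟨hT.treeLike, by omega⟩, by omega⟩
      · exact fun h => ⟨⟨⟨hTT'.isTreeLike hT, by omega⟩, le_rfl⟩, by omega⟩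

/-- The binomial expansion of `(y + 1) ^ m - y ^ m`. -/
theorem sum_choose_succ_smul_pow {R : Type*} [CommRing R] (y : R) (m : ℕ) :
    ∑ k ∈ Finset.range m, m.choose (k + 1) • y ^ (m - (k + 1)) = (y + 1) ^ m - y ^ m := by
  rw [add_comm y 1, add_pow, Finset.sum_range_succ']
  simp only [one_pow, one_mul, Nat.choose_zero_right, Nat.cast_one, mul_one, Nat.sub_zero,
    add_sub_cancel_right, nsmul_eq_mul]
  exact Finset.sum_congr rfl fun k _ => mul_comm _ _

/-- The induction runs on the excess `d` of the size over the bound for the last row: all terms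
produced by the recursion have the same excess, one less than before. With `P` the product and `y =
x + d`, they add up to `P y ^ (m + 1) + P y ((y + 1) ^ m - y ^ m) = P y (y + 1) ^ m`. -/
theorem sum_treeLikeFinset {R : Type*} [CommRing R] (x : R) (d : ℕ) : ∀ m : ℕ, 0 < m →
    ∑ T ∈ treeLikeFinset (m + d) m, x ^ T.firstRowPoints =
      (∏ i ∈ Finset.range d, (x + i)) * (x + d) ^ m := by
  induction d with
  | zero =>
    intro m hm
    simpa using sum_treeLikeFinset_self x m hm
  | succ d ih =>
    intro m hm
    rw [sum_treeLikeFinset_step x (by omega), show m + (d + 1) = m + 1 + d by ring,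
      ih (m + 1) (by omega)]
    have h1 : ∀ k ∈ Finset.range m, m.choose (k + 1) •
          ∑ T ∈ treeLikeFinset (m + 1 + d - (k + 1)) (m - k), x ^ T.firstRowPoints =
        ((∏ i ∈ Finset.range d, (x + i)) * (x + d)) *
          (m.choose (k + 1) • (x + d) ^ (m - (k + 1))) := by
      intro k hk
      have hk := Finset.mem_range.1 hk
      rw [show m + 1 + d - (k + 1) = (m - k) + d by omega, ih _ (by omega),
        show m - k = m - (k + 1) + 1 by omega, pow_succ, nsmul_eq_mul, nsmul_eq_mul]
      ring
    rw [Finset.sum_congr rfl h1, ← Finset.mul_sum, sum_choose_succ_smul_pow,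
      Finset.prod_range_succ]
    push_cast
    ring

theorem card_nonAmbiguousTreeFinset_zero (w : ℕ) : (nonAmbiguousTreeFinset 0 w).card = 1 := by
  have h : nonAmbiguousTreeFinset 0 w = treeLikeFinset (w + 1) (w + 1) := by
    ext T
    rw [mem_nonAmbiguousTreeFinset, isNonAmbiguousTree_iff, mem_treeLikeFinset]
    have h4 := T.lastRowLen_le_numCols
    constructor
    · rintro ⟨h, h1, h2, h3⟩
      have := h.size_add_one
      exact ⟨⟨h, by omega⟩, by omega⟩
    · rintro ⟨⟨h, h1⟩, h2⟩
      have := h.size_add_one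
      have := h.numRows_pos
      exact ⟨h, by omega, by omega, by omega⟩
  have := sum_treeLikeFinset_self (1 : ℤ) (w + 1) (Nat.succ_pos _)
  simp only [one_pow, Finset.sum_const, nsmul_eq_mul, mul_one] at this
  rw [h]
  exact_mod_cast this

/-- Removing a full last row with `k + 1` points from a rectangle leaves a rectangle with `k` fewer
columns. -/
theorem card_nonAmbiguousTreeFinset_succ (h w : ℕ) :
    ((nonAmbiguousTreeFinset (h + 1) w).card : ℤ) = ∑ k ∈ Finset.range (w + 1),
      (w + 1).choose (k + 1) • ((nonAmbiguousTreeFinset h (w - k)).card : ℤ) := by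
  have h1 := sum_eq_sum_rowExt (w + 1) (nonAmbiguousTreeFinset (h + 1) w)
    (fun D => nonAmbiguousTreeFinset h (w + 1 - D.card)) (fun _ => (1 : ℤ)) ?_ ?_ ?_
  · have h2 := sum_powerset_erase_empty (w + 1)
      (fun k => ((nonAmbiguousTreeFinset h (w + 1 - k)).card : ℤ))
    simp only [Finset.sum_const, nsmul_eq_mul, mul_one, Nat.add_sub_add_right] at h1 h2 ⊢
    rw [h1, h2]
  · intro T hT
    obtain ⟨h1, h2, h3, h4⟩ := isNonAmbiguousTree_iff.1 (mem_nonAmbiguousTreeFinset.1 hT)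
    exact ⟨h1, by omega, h4⟩
  · intro D hD hne T hT
    obtain ⟨h1, h2, h3, h4⟩ := isNonAmbiguousTree_iff.1 (mem_nonAmbiguousTreeFinset.1 hT)
    have := card_nonMin hne
    exact ⟨h1, hne, hD, by omega⟩
  · intro D T T' hT hTT'
    have h1 := card_nonMin hT.nonempty
    have h2 := Finset.card_le_card hT.subset
    rw [Finset.card_range] at h2
    have h3 := hT.le
    have h4 := T.lastRowLen_le_numCols
    rw [mem_nonAmbiguousTreeFinset, mem_nonAmbiguousTreeFinset, isNonAmbiguousTree_iff,
      isNonAmbiguousTree_iff, hTT'.numRows_eq hT, hTT'.numCols_eq hT, hTT'.lastRowLen_eq hT]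
    constructor
    · exact fun h => ⟨hT.treeLike, by omega, by omega, by omega⟩
    · exact fun h => ⟨hTT'.isTreeLike hT, by omega, by omega, rfl⟩

/-- The operator that sends `f` to `u ↦ (u + 1) f (u + 1) - u f u`. -/
def diffMul : Module.End ℤ (ℕ → ℤ) where
  toFun f u := (u + 1) * f (u + 1) - u * f u
  map_add' f g := by ext u; simp only [Pi.add_apply]; ring
  map_smul' c f := by ext u; simp only [Pi.smul_apply, smul_eq_mul, RingHom.id_apply]; ring

theorem diffMul_apply (f : ℕ → ℤ) (u : ℕ) :
    diffMul f u = (u + 1) * f (u + 1) - u * f u := rfl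

/-- `diffMul` sends `u ^ w` to `(u + 1) ^ (w + 1) - u ^ (w + 1)`, whose binomial coefficients are
those of the recursion on the height. -/
theorem card_nonAmbiguousTreeFinset (h : ℕ) : ∀ w : ℕ,
    ((nonAmbiguousTreeFinset h w).card : ℤ) = (diffMul ^ h) (fun u => (u : ℤ) ^ w) 1 := by
  induction h with
  | zero => intro w; simp [card_nonAmbiguousTreeFinset_zero]
  | succ h ih =>
    intro w
    have h1 : diffMul (fun u => (u : ℤ) ^ w) = ∑ k ∈ Finset.range (w + 1),
        (w + 1).choose (k + 1) • (fun u : ℕ => (u : ℤ) ^ (w - k)) := by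
      ext u
      have := sum_choose_succ_smul_pow (u : ℤ) (w + 1)
      simp only [Nat.add_sub_add_right] at this
      rw [diffMul_apply, Finset.sum_apply]
      simp only [Pi.smul_apply]
      rw [this]
      push_cast
      ring
    rw [card_nonAmbiguousTreeFinset_succ, pow_succ, Module.End.mul_apply, h1, map_sum,
      Finset.sum_apply]
    refine Finset.sum_congr rfl fun k _ => ?_
    rw [ih, map_nsmul, Pi.smul_apply]

end PointedTableau

/-! ### Counting the triplets with given sizes -/

namespace PointedTableau

theorem finite_setOf_treeLike_or_empty (n : ℕ) :
    {T : PointedTableau | (T.IsTreeLike ∨ T.IsEmptyTableau) ∧ T.size = n}.Finite := by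
  refine ((finite_setOf_isTreeLike n).union (finite_setOf_numRows_numCols_le 0)).subset ?_
  rintro T ⟨h | h, hs⟩
  · exact Or.inl ⟨h, hs⟩
  · rw [isEmptyTableau_iff] at h
    exact Or.inr ⟨not_lt.1 fun hlt => h _ _ (lt_numRows_iff.1 hlt),
      not_lt.1 fun hlt => h _ _ (lt_numCols_iff.1 hlt)⟩

/-- The tree-like tableaux of size `n`, including the empty tableau if `n = 0`. -/
noncomputable def treeLikeOrEmptyFinset (n : ℕ) : Finset PointedTableau :=
  (finite_setOf_treeLike_or_empty n).toFinset

theorem mem_treeLikeOrEmptyFinset {n : ℕ} {T : PointedTableau} :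
    T ∈ treeLikeOrEmptyFinset n ↔ (T.IsTreeLike ∨ T.IsEmptyTableau) ∧ T.size = n := by
  simp [treeLikeOrEmptyFinset]

/-- For positive size this is the bound `m = 1` on the last row, which excludes nothing. The empty
tableau has weight `x ^ 0`, matching the empty product. -/
theorem sum_treeLikeOrEmptyFinset {R : Type*} [CommRing R] (x : R) (n : ℕ) :
    ∑ T ∈ treeLikeOrEmptyFinset n, x ^ T.firstRowPoints = ∏ i ∈ Finset.range n, (x + i) := by
  rcases n with - | n
  · obtain ⟨T, h1, h2⟩ := exists_of_mem (fun _ _ => False) (fun _ _ => False) 0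
      (by simp) (by simp) (by simp)
    have hT : T.IsEmptyTableau := isEmptyTableau_iff.2 fun i j h => (h1 i j).1 h
    have hsing : treeLikeOrEmptyFinset 0 = {T} := by
      refine Finset.eq_singleton_iff_unique_mem.2 ⟨?_, fun T' hT' => ?_⟩
      · exact mem_treeLikeOrEmptyFinset.2 ⟨Or.inr hT, by rw [size, hT.points, Finset.card_empty]⟩
      · obtain ⟨h | h, hs⟩ := mem_treeLikeOrEmptyFinset.1 hT'
        · have := h.size_add_one
          have := h.numRows_pos
          have := h.numCols_pos
          omega
        · refine ext_mem (fun i j => ?_) (fun i j => ?_)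
          · rw [h1, iff_false]; exact isEmptyTableau_iff.1 h i j
          · rw [h2, h.points]; simp
    rw [hsing, Finset.sum_singleton, firstRowPoints, hT.points]
    simp
  · have h : treeLikeOrEmptyFinset (n + 1) = treeLikeFinset (1 + n) 1 := by
      ext T
      rw [mem_treeLikeOrEmptyFinset, mem_treeLikeFinset, add_comm]
      constructor
      · rintro ⟨h | h, hs⟩
        · exact ⟨⟨h, hs⟩, lastRowLen_pos h.numRows_pos⟩
        · rw [size, h.points, Finset.card_empty] at hs
          omega
      · exact fun h => ⟨Or.inl h.1.1, h.1.2⟩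
    rw [h, sum_treeLikeFinset x n 1 one_pos, Finset.prod_range_succ, pow_one]

theorem transpose_mem_treeLikeOrEmptyFinset {n : ℕ} {T : PointedTableau}
    (h : T ∈ treeLikeOrEmptyFinset n) : T.transpose ∈ treeLikeOrEmptyFinset n := by
  rw [mem_treeLikeOrEmptyFinset] at *
  rw [transpose_size]
  exact ⟨h.1.imp IsTreeLike.transpose IsEmptyTableau.transpose, h.2⟩

theorem sum_treeLikeOrEmptyFinset_firstColPoints {R : Type*} [CommRing R] (x : R) (n : ℕ) :
    ∑ T ∈ treeLikeOrEmptyFinset n, x ^ T.firstColPoints = ∏ i ∈ Finset.range n, (x + i) := by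
  rw [← sum_treeLikeOrEmptyFinset]
  exact Finset.sum_bij' (fun T _ => T.transpose) (fun T _ => T.transpose)
    (fun _ => transpose_mem_treeLikeOrEmptyFinset) (fun _ => transpose_mem_treeLikeOrEmptyFinset)
    (fun T _ => T.transpose_transpose) (fun T _ => T.transpose_transpose)
    (fun T _ => by rw [transpose_firstRowPoints])

/-- The operator `D (D + 1) ⋯ (D + b - 1)`, where `D` is `diffMul`. -/
noncomputable def risingDiffMul (b : ℕ) : Module.End ℤ (ℕ → ℤ) :=
  Polynomial.aeval diffMul (∏ i ∈ Finset.range b, (Polynomial.X + (i : Polynomial ℤ)))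

theorem risingDiffMul_zero_apply (f : ℕ → ℤ) : risingDiffMul 0 f = f := by
  simp [risingDiffMul]

theorem risingDiffMul_succ_apply (b : ℕ) (f : ℕ → ℤ) (u : ℕ) :
    risingDiffMul (b + 1) f u =
      (u + 1) * risingDiffMul b f (u + 1) - (u - b) * risingDiffMul b f u := by
  have h : risingDiffMul (b + 1) = (diffMul + (b : Module.End ℤ (ℕ → ℤ))) * risingDiffMul b := by
    rw [risingDiffMul, Finset.prod_range_succ, mul_comm, map_mul, map_add, Polynomial.aeval_X,
      map_natCast, risingDiffMul]
  rw [h, Module.End.mul_apply, LinearMap.add_apply, Pi.add_apply, diffMul_apply,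
    Module.End.natCast_apply, Pi.smul_apply, nsmul_eq_mul]
  ring

/-- The rising factorial `u (u + 1) ⋯ (u + a - 1)` as a function of `u`. -/
def risingFun (a : ℕ) (u : ℕ) : ℤ := ∏ i ∈ Finset.range a, ((u : ℤ) + i)

/-- Each summand is `diffMul ^ i` applied to `u ^ j` at `u = 1`, with `i` depending on `Tr` alone
and `j` on `Tl` alone. Linearity lets the two sums be taken separately, and each is a rising
factorial. -/
theorem sum_card_nonAmbiguousTreeFinset (a b : ℕ) :
    ∑ p ∈ treeLikeOrEmptyFinset a ×ˢ treeLikeOrEmptyFinset b,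
      ((nonAmbiguousTreeFinset p.2.firstColPoints p.1.firstRowPoints).card : ℤ) =
      risingDiffMul b (risingFun a) 1 := by
  have h1 : risingFun a =
      ∑ T ∈ treeLikeOrEmptyFinset a, fun u : ℕ => (u : ℤ) ^ T.firstRowPoints := by
    ext u
    rw [Finset.sum_apply, sum_treeLikeOrEmptyFinset, risingFun]
  have h2 : risingDiffMul b = ∑ T ∈ treeLikeOrEmptyFinset b, diffMul ^ T.firstColPoints := by
    rw [risingDiffMul, ← sum_treeLikeOrEmptyFinset_firstColPoints, map_sum]
    simp only [map_pow, Polynomial.aeval_X]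
  rw [Finset.sum_product, h1, map_sum, Finset.sum_apply]
  refine Finset.sum_congr rfl fun Tl _ => ?_
  rw [h2, LinearMap.sum_apply, Finset.sum_apply]
  exact Finset.sum_congr rfl fun Tr _ => card_nonAmbiguousTreeFinset _ _

/-- `diffMul` fixes constants, so the factor `D + i` multiplies them by `i + 1`. -/
theorem risingDiffMul_risingFun_zero (b : ℕ) :
    risingDiffMul b (risingFun 0) = fun _ => (b.factorial : ℤ) := by
  induction b with
  | zero => ext u; simp [risingDiffMul_zero_apply, risingFun]
  | succ b ih =>
    ext u
    rw [risingDiffMul_succ_apply, ih, Nat.factorial_succ]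
    push_cast
    ring

/-- The result is needed only at `u = 1`, but the induction on `b` involves the values at `u` and `u
+ 1`, hence a formula for all `u`. -/
theorem risingDiffMul_risingFun_succ (a b u : ℕ) :
    risingDiffMul (b + 1) (risingFun (a + 1)) u = risingFun a (u + 1) *
      ((a + 2).ascFactorial b * ((a + b + 2) * u + (a + 1) * (b + 1))) := by
  -- The factor `u + 1` contributed by the operator turns the shifted product back into the common
  -- factor `risingFun a (u + 1)`; what remains is a polynomial identity.
  have key : ∀ u : ℕ, ((u : ℤ) + 1) * risingFun a (u + 2) = risingFun a (u + 1) * (u + a + 1) := by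
    intro u
    have h1 := Finset.prod_range_succ (fun i : ℕ => ((u : ℤ) + 1) + i) a
    rw [Finset.prod_range_succ'] at h1
    simp only [risingFun]
    push_cast at h1 ⊢
    rw [add_zero] at h1
    calc _ = (∏ k ∈ Finset.range a, ((u : ℤ) + 1 + (k + 1))) * (u + 1) := by
            rw [mul_comm]
            congr 1
            exact Finset.prod_congr rfl fun _ _ => by ring
      _ = _ := by rw [h1]; ring
  induction b generalizing u with
  | zero =>
    have h : ∀ u : ℕ, risingFun (a + 1) u = u * risingFun a (u + 1) := by
      intro u
      rw [risingFun, Finset.prod_range_succ', mul_comm]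
      simp only [risingFun]
      push_cast
      rw [add_zero]
      congr 1
      exact Finset.prod_congr rfl fun _ _ => by ring
    rw [risingDiffMul_succ_apply, risingDiffMul_zero_apply, h, h, Nat.ascFactorial_zero]
    push_cast
    linear_combination ((u : ℤ) + 1) * key u
  | succ b ih =>
    rw [risingDiffMul_succ_apply, ih, ih, Nat.ascFactorial_succ]
    push_cast
    linear_combination ((a + 2).ascFactorial b : ℤ) *
      ((a + b + 2) * (u + 1) + (a + 1) * (b + 1)) * key u

/-- The common number of triplets and of runs of size one. -/
def cornerCount (a b : ℕ) : ℕ :=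
  if a + b = 0 then 1 else (a + b - 1).factorial * (a + b + a * b)

theorem cornerCount_pos (a b : ℕ) : 0 < cornerCount a b := by
  rw [cornerCount]
  split_ifs with h
  · exact one_pos
  · have := Nat.factorial_pos (a + b - 1)
    positivity

/-- The closed form covers positive `a` and `b`. If one of them is `0`, the value is the factorial
of the other. -/
theorem risingDiffMul_risingFun_one (a b : ℕ) :
    risingDiffMul b (risingFun a) 1 = cornerCount a b := by
  have hfac : ∀ n, ∏ i ∈ Finset.range n, ((1 : ℤ) + i) = n.factorial := by
    intro n
    rw [← Finset.prod_range_add_one_eq_factorial]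
    push_cast
    exact Finset.prod_congr rfl fun _ _ => add_comm _ _
  rcases a with - | a
  · rw [risingDiffMul_risingFun_zero]
    rcases b with - | b
    · rfl
    · rw [cornerCount, if_neg (by omega), Nat.factorial_succ]
      simp [mul_comm]
  · rw [cornerCount, if_neg (by omega)]
    rcases b with - | b
    · rw [risingDiffMul_zero_apply, risingFun, Nat.cast_one, hfac, Nat.factorial_succ]
      simp [mul_comm]
    · have h1 : risingFun a 2 = ((a + 1).factorial : ℤ) := by
        rw [← hfac, Finset.prod_range_succ', risingFun]
        push_cast
        rw [mul_one]
        exact Finset.prod_congr rfl fun _ _ => by ring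
      rw [risingDiffMul_risingFun_succ, h1, show a + 1 + (b + 1) - 1 = a + 1 + b by omega,
        ← Nat.factorial_mul_ascFactorial (a + 1) b]
      push_cast
      ring

theorem card_cutTriplet_fiber (a b : ℕ) :
    Nat.card {t : CutTriplet (a + b + 1) // t.Tl.size = a} = cornerCount a b := by
  let F := (treeLikeOrEmptyFinset a ×ˢ treeLikeOrEmptyFinset b).sigma
    fun p => nonAmbiguousTreeFinset p.2.firstColPoints p.1.firstRowPoints
  have hF : F.card = cornerCount a b := by
    have h := sum_card_nonAmbiguousTreeFinset a b
    rw [risingDiffMul_risingFun_one] at h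
    rw [Finset.card_sigma]
    exact_mod_cast h
  have hmem : ∀ Tl Tr N : PointedTableau, (⟨(Tl, Tr), N⟩ :
      (_ : PointedTableau × PointedTableau) × PointedTableau) ∈ F ↔
      (((Tl.IsTreeLike ∨ Tl.IsEmptyTableau) ∧ Tl.size = a) ∧
        (Tr.IsTreeLike ∨ Tr.IsEmptyTableau) ∧ Tr.size = b) ∧
        N.IsNonAmbiguousTree Tr.firstColPoints Tl.firstRowPoints := fun Tl Tr N => by
    simp only [F, Finset.mem_sigma, Finset.mem_product, mem_treeLikeOrEmptyFinset,
      mem_nonAmbiguousTreeFinset]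
  rw [← hF, ← Nat.card_eq_finsetCard]
  refine Nat.card_congr
    { toFun := fun t => ⟨⟨(t.1.Tl, t.1.Tr), t.1.N⟩, (hmem _ _ _).2
        ⟨⟨⟨t.1.left_treeLike, t.2⟩, t.1.right_treeLike, ?_⟩, t.1.nat_tree⟩⟩
      invFun := fun x => ⟨⟨x.1.1.1, x.1.1.2, x.1.2, ((hmem _ _ _).1 x.2).1.1.1,
        ((hmem _ _ _).1 x.2).1.2.1, ?_, ((hmem _ _ _).1 x.2).2⟩, ((hmem _ _ _).1 x.2).1.1.2⟩
      left_inv := fun _ => rfl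
      right_inv := fun _ => rfl }
  · have h1 := t.1.size_eq
    have h2 := t.2
    omega
  · have h1 : x.1.1.1.size = a := ((hmem _ _ _).1 x.2).1.1.2
    have h2 : x.1.1.2.size = b := ((hmem _ _ _).1 x.2).1.2.2
    omega

end PointedTableau

/-! ### Counting permutations with a run of size one at a given letter -/

/-- Composition with the inverse of one solution `τ` turns the solutions into the permutations
fixing the range of `P` pointwise, that is, into the permutations of its complement. -/
theorem card_perm_comp_eq {n k : ℕ} {P V : Fin k → Fin n} (hP : P.Injective) (hV : V.Injective) :
    (Finset.univ.filter fun σ : Equiv.Perm (Fin n) => σ ∘ P = V).card = (n - k).factorial := by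
  classical
  obtain ⟨τ, hτ⟩ : ∃ τ : Equiv.Perm (Fin n), ∀ i, τ (P i) = V i := by
    let e : {x // x ∈ Set.range P} ≃ {x // x ∈ Set.range V} :=
      (Equiv.ofInjective P hP).symm.trans (Equiv.ofInjective V hV)
    refine ⟨e.extendSubtype, fun i => ?_⟩
    rw [e.extendSubtype_apply_of_mem _ (Set.mem_range_self i)]
    change ((Equiv.ofInjective V hV) ((Equiv.ofInjective P hP).symm ⟨P i, _⟩) : Fin n) = _
    rw [Equiv.ofInjective_symm_apply]
    rfl
  have h1 : (Finset.univ.filter fun σ : Equiv.Perm (Fin n) => σ ∘ P = V).card =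
      Nat.card {f : Equiv.Perm (Fin n) // ∀ x, ¬ x ∉ Set.range P → f x = x} := by
    rw [← Nat.card_eq_finsetCard]
    refine Nat.card_congr ((Equiv.mulLeft τ⁻¹).subtypeEquiv fun σ => ?_)
    rw [Finset.mem_filter_univ, funext_iff]
    simp only [Function.comp_apply, not_not, Set.forall_mem_range, Equiv.coe_mulLeft,
      Equiv.Perm.mul_apply, Equiv.Perm.inv_eq_iff_eq, hτ]
  rw [h1, ← Nat.card_congr (Equiv.Perm.subtypeEquivSubtypePerm fun x => x ∉ Set.range P),
    Nat.card_perm, Nat.card_eq_fintype_card, Fintype.card_subtype_compl, Fintype.card_fin]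
  congr 2
  exact (Set.card_range_of_injective hP).trans (Fintype.card_fin k)

theorem card_perm_comp_mem {n k : ℕ} {P : Fin k → Fin n} (hP : P.Injective)
    (S : Finset (Fin k → Fin n)) (hS : ∀ V ∈ S, V.Injective) :
    (Finset.univ.filter fun σ : Equiv.Perm (Fin n) => σ ∘ P ∈ S).card =
      S.card * (n - k).factorial := by
  rw [Finset.card_eq_sum_card_fiberwise (f := fun σ : Equiv.Perm (Fin n) => σ ∘ P) (t := S)
    (fun σ hσ => by simpa using hσ), ← smul_eq_mul, ← Finset.sum_const]
  refine Finset.sum_congr rfl fun V hV => ?_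
  rw [← card_perm_comp_eq hP (hS V hV), Finset.filter_filter]
  congr 1
  ext σ
  simp only [Finset.mem_filter_univ]
  exact ⟨fun h => h.2, fun h => ⟨h ▸ hV, h⟩⟩

/-- The permutations with a run of size one at the position `p` whose only letter is `a`, where
positions and values are numbered from `0`. -/
def runPerms (n a : ℕ) (p : Fin n) : Finset (Equiv.Perm (Fin n)) :=
  Finset.univ.filter fun σ => (σ p : ℕ) = a ∧ (∀ q : Fin n, (q : ℕ) + 1 = p → a < σ q) ∧
    ∀ q : Fin n, (q : ℕ) = p + 1 → σ q < a

theorem mem_runPerms {n a : ℕ} {p : Fin n} {σ : Equiv.Perm (Fin n)} :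
    σ ∈ runPerms n a p ↔ (σ p : ℕ) = a ∧ (∀ q : Fin n, (q : ℕ) + 1 = p → a < σ q) ∧
      ∀ q : Fin n, (q : ℕ) = p + 1 → σ q < a := by
  simp [runPerms]

theorem permWord_succ {n : ℕ} (σ : Equiv.Perm (Fin n)) (p : Fin n) :
    permWord σ (p + 1) = σ p + 1 := by
  simp [permWord]

theorem permWord_eq_zero {n : ℕ} (σ : Equiv.Perm (Fin n)) {i : ℕ} (h : n < i) :
    permWord σ i = 0 := by
  rw [permWord, if_neg (by omega), dif_neg (by omega)]

/-- The boundary values `n + 1` and `0` make the inequalities at the two ends automatic, so only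
neighbours that exist impose a condition. -/
theorem isAscendingRun_one_iff {n a : ℕ} {σ : Equiv.Perm (Fin n)} {p : Fin n} :
    IsAscendingRun σ (p + 1) 1 ∧ permWord σ (p + 1) = a + 1 ↔ σ ∈ runPerms n a p := by
  have hp := p.2
  rw [mem_runPerms, permWord_succ, add_left_inj]
  constructor
  · rintro ⟨⟨-, -, -, h1, -, h2⟩, ha⟩
    rw [Nat.add_sub_cancel, permWord_succ] at h1 h2
    refine ⟨ha, fun q hq => ?_, fun q hq => ?_⟩
    · rw [← hq, permWord_succ] at h1
      omega
    · rw [← hq, permWord_succ] at h2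
      omega
  · rintro ⟨ha, h1, h2⟩
    refine ⟨⟨le_rfl, by omega, by omega, ?_, by omega, ?_⟩, ha⟩
    · rw [Nat.add_sub_cancel, permWord_succ]
      rcases Nat.eq_zero_or_pos (p : ℕ) with h0 | h0
      · rw [h0, permWord, if_pos rfl]
        have := (σ p).2
        omega
      · have h3 := h1 ⟨p - 1, by omega⟩ (by simp only; omega)
        have h4 := permWord_succ σ ⟨p - 1, by omega⟩
        simp only [Nat.sub_add_cancel h0] at h4
        omega
    · rw [Nat.add_sub_cancel, permWord_succ]
      rcases Nat.lt_or_ge ((p : ℕ) + 1) n with h0 | h0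
      · have h3 := h2 ⟨p + 1, h0⟩ rfl
        have h4 := permWord_succ σ ⟨p + 1, h0⟩
        simp only at h4
        omega
      · rw [permWord_eq_zero σ (by omega)]
        omega

theorem card_sizeOneRun_fiber_eq_sum (n a : ℕ) :
    Nat.card {x : SizeOneRun n // permWord x.1.1 x.1.2 = a + 1} =
      ∑ p, (runPerms n a p).card := by
  have hlt : ∀ x : SizeOneRun n, x.1.2 - 1 < n ∧ x.1.2 - 1 + 1 = x.1.2 := fun x => by
    obtain ⟨-, h1, h2, -⟩ := x.2
    omega
  rw [← Finset.card_sigma, ← Nat.card_eq_finsetCard]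
  refine Nat.card_congr
    { toFun := fun x => ⟨⟨⟨x.1.1.2 - 1, (hlt x.1).1⟩, x.1.1.1⟩, Finset.mem_sigma.2
        ⟨Finset.mem_univ _, isAscendingRun_one_iff.1 ?_⟩⟩
      invFun := fun y => ⟨⟨(y.1.2, y.1.1 + 1),
        (isAscendingRun_one_iff.2 (Finset.mem_sigma.1 y.2).2).1⟩,
        (isAscendingRun_one_iff.2 (Finset.mem_sigma.1 y.2).2).2⟩
      left_inv := fun x => Subtype.ext (Subtype.ext (Prod.ext rfl (hlt x.1).2))
      right_inv := fun y => rfl }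
  simp only [(hlt x.1).2]
  exact ⟨x.1.2, x.2⟩

theorem injective_vec_two {α : Type*} {x y : α} (h : x ≠ y) :
    Function.Injective ![x, y] := by
  intro i j
  fin_cases i <;> fin_cases j <;> simp [h, h.symm]

theorem injective_vec_three {α : Type*} {x y z : α} (h : x ≠ y) (h' : x ≠ z) (h'' : y ≠ z) :
    Function.Injective ![x, y, z] := by
  intro i j
  fin_cases i <;> fin_cases j <;> simp [h, h.symm, h', h'.symm, h'', h''.symm]

theorem card_perm_two {n : ℕ} {p q a : Fin n} (hpq : p ≠ q) {S : Finset (Fin n)} (ha : a ∉ S) :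
    (Finset.univ.filter fun σ : Equiv.Perm (Fin n) => σ p = a ∧ σ q ∈ S).card =
      S.card * (n - 2).factorial := by
  have h := card_perm_comp_mem (injective_vec_two hpq) (S.image fun s => ![a, s]) (by
    intro V hV
    obtain ⟨s, hs, rfl⟩ := Finset.mem_image.1 hV
    exact injective_vec_two fun h => ha (h ▸ hs))
  rw [Finset.card_image_of_injective _ fun s s' h => by simpa using congrFun h 1] at h
  rw [← h]
  congr 1
  ext σ
  simp only [Finset.mem_filter_univ, Finset.mem_image, funext_iff, Fin.forall_fin_two,
    Function.comp_apply, Matrix.cons_val_zero, Matrix.cons_val_one]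
  constructor
  · rintro ⟨h1, h2⟩
    exact ⟨_, h2, h1.symm, rfl⟩
  · rintro ⟨s, hs, h1, h2⟩
    exact ⟨h1.symm, h2 ▸ hs⟩

theorem card_perm_three {n : ℕ} {p q r a : Fin n} (hpq : p ≠ q) (hpr : p ≠ r) (hqr : q ≠ r)
    {L S : Finset (Fin n)} (haL : a ∉ L) (haS : a ∉ S) (hLS : Disjoint L S) :
    (Finset.univ.filter fun σ : Equiv.Perm (Fin n) => σ p = a ∧ σ q ∈ L ∧ σ r ∈ S).card =
      L.card * S.card * (n - 3).factorial := by
  have h := card_perm_comp_mem (injective_vec_three hpq hpr hqr)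
    ((L ×ˢ S).image fun s => ![a, s.1, s.2]) (by
      intro V hV
      obtain ⟨⟨l, s⟩, hs, rfl⟩ := Finset.mem_image.1 hV
      obtain ⟨hl, hs⟩ := Finset.mem_product.1 hs
      exact injective_vec_three (fun h => haL (h ▸ hl)) (fun h => haS (h ▸ hs))
        (Finset.disjoint_iff_ne.1 hLS _ hl _ hs))
  rw [Finset.card_image_of_injective _ fun s s' h =>
    Prod.ext (by simpa using congrFun h 1) (by simpa using congrFun h 2),
    Finset.card_product] at h
  rw [← h]
  congr 1
  ext σ
  simp only [Finset.mem_filter_univ, Finset.mem_image, funext_iff, Fin.forall_fin_succ,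
    Function.comp_apply, Finset.mem_product, Prod.exists]
  constructor
  · rintro ⟨h1, h2, h3⟩
    exact ⟨_, _, ⟨h2, h3⟩, h1.symm, rfl, rfl, fun i => i.elim0⟩
  · rintro ⟨l, s, ⟨hl, hs⟩, h1, h2, h3, -⟩
    refine ⟨h1.symm, ?_, ?_⟩
    · exact (h2 : l = σ q) ▸ hl
    · exact (h3 : s = σ r) ▸ hs

theorem card_runPerms_first {N a b : ℕ} (hN : a + b = N + 1) :
    (runPerms (N + 2) a 0).card = a * N.factorial := by
  let k : Fin (N + 2) := ⟨a, by omega⟩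
  have h := card_perm_two (p := 0) (q := 1) (a := k) (S := Finset.Iio k) (by simp) (by simp)
  rw [Fin.card_Iio, Nat.add_sub_cancel] at h
  rw [← h]
  congr 1
  ext σ
  simp only [mem_runPerms, Finset.mem_filter_univ, Finset.mem_Iio, Fin.ext_iff, Fin.lt_def]
  constructor
  · exact fun h => ⟨h.1, h.2.2 1 (by simp)⟩
  · refine fun h => ⟨h.1, fun q hq => by simp at hq, fun q hq => ?_⟩
    obtain rfl : q = 1 := Fin.ext (by simpa using hq)
    exact h.2

theorem card_runPerms_last {N a b : ℕ} (hN : a + b = N + 1) :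
    (runPerms (N + 2) a (Fin.last (N + 1))).card = b * N.factorial := by
  let k : Fin (N + 2) := ⟨a, by omega⟩
  have h := card_perm_two (p := Fin.last (N + 1)) (q := ⟨N, by omega⟩) (a := k)
    (S := Finset.Ioi k) (by simp [Fin.ext_iff]) (by simp)
  rw [Fin.card_Ioi, show N + 2 - 1 - (k : ℕ) = b by simp only [k]; omega,
    show N + 1 + 1 - 2 = N by omega] at h
  rw [← h]
  congr 1
  ext σ
  simp only [mem_runPerms, Finset.mem_filter_univ, Finset.mem_Ioi, Fin.ext_iff, Fin.lt_def]
  constructor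
  · exact fun h => ⟨h.1, h.2.1 ⟨N, by omega⟩ (by simp)⟩
  · refine fun h => ⟨h.1, fun q hq => ?_, fun q hq => ?_⟩
    · rw [show q = ⟨N, by omega⟩ from Fin.ext (by simpa using hq)]
      exact h.2
    · have := q.2
      simp only [Fin.val_last] at hq
      omega

theorem card_runPerms_middle {N a b : ℕ} (hN : a + b = N + 1) (i : Fin N) :
    (runPerms (N + 2) a i.castSucc.succ).card = a * b * (N - 1).factorial := by
  let k : Fin (N + 2) := ⟨a, by omega⟩
  have hi := i.2
  have h := card_perm_three (p := i.castSucc.succ) (q := ⟨i, by omega⟩) (r := ⟨i + 2, by omega⟩)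
    (a := k) (L := Finset.Ioi k) (S := Finset.Iio k) (by simp [Fin.ext_iff])
    (by simp [Fin.ext_iff]) (by simp [Fin.ext_iff]) (by simp) (by simp)
    (Finset.disjoint_left.2 fun x h1 h2 =>
      (Finset.mem_Ioi.1 h1).not_gt (Finset.mem_Iio.1 h2))
  rw [Fin.card_Ioi, Fin.card_Iio, show N + 2 - 1 - (k : ℕ) = b by simp only [k]; omega,
    show N + 2 - 3 = N - 1 by omega, mul_comm b] at h
  rw [← h]
  congr 1
  ext σ
  simp only [mem_runPerms, Finset.mem_filter_univ, Finset.mem_Ioi, Finset.mem_Iio, Fin.ext_iff,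
    Fin.lt_def, Fin.val_succ, Fin.val_castSucc]
  constructor
  · exact fun h => ⟨h.1, h.2.1 ⟨i, by omega⟩ rfl, h.2.2 ⟨i + 2, by omega⟩ rfl⟩
  · refine fun h => ⟨h.1, fun q hq => ?_, fun q hq => ?_⟩
    · rw [show q = ⟨i, by omega⟩ from Fin.ext (by simpa using hq)]
      exact h.2.1
    · rw [show q = ⟨i + 2, by omega⟩ from Fin.ext (by simpa using hq)]
      exact h.2.2

-- With `a + b = N + 1`, a first position needs one smaller neighbour, a last one needs one larger
-- neighbour, and each of the `N` others needs both. The total is `(a + b) N! + N a b (N - 1)!`.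
open PointedTableau in
theorem card_sizeOneRun_fiber (a b : ℕ) :
    Nat.card {x : SizeOneRun (a + b + 1) // permWord x.1.1 x.1.2 = a + 1} = cornerCount a b := by
  rw [card_sizeOneRun_fiber_eq_sum, cornerCount]
  rcases Nat.eq_zero_or_pos (a + b) with h0 | h0
  · obtain ⟨rfl, rfl⟩ : a = 0 ∧ b = 0 := by omega
    decide
  · obtain ⟨N, hN⟩ : ∃ N, a + b = N + 1 := ⟨a + b - 1, by omega⟩
    rw [if_neg (by omega), hN, Fin.sum_univ_succ, Fin.sum_univ_castSucc,
      card_runPerms_first hN, Fin.succ_last, card_runPerms_last hN,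
      Finset.sum_congr rfl fun i _ => card_runPerms_middle hN i,
      Finset.sum_const, Finset.card_univ, Fintype.card_fin, smul_eq_mul, Nat.add_sub_cancel]
    -- For `N = 0` there is no inner position, and `a b = 0` because `a + b = 1`.
    rcases N with - | N
    · have : a * b = 0 := by
        rcases Nat.eq_zero_or_pos a with h | h
        · simp [h]
        · have : b = 0 := by omega
          simp [this]
      simp [this]
      omega
    · rw [Nat.add_sub_cancel, Nat.factorial_succ, ← hN]
      ring

/-! ### Matching the fibres -/

/-- For `1 ≤ c ≤ n` the two fibres have the same cardinality; for any other `c` both are empty. -/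
theorem nonempty_fiber_equiv (n c : ℕ) :
    Nonempty ({t : CutTriplet n // t.Tl.size + 1 = c} ≃
      {x : SizeOneRun n // permWord x.1.1 x.1.2 = c}) := by
  rcases c with - | a
  · have h1 : IsEmpty {t : CutTriplet n // t.Tl.size + 1 = 0} := ⟨fun t => by simpa using t.2⟩
    have h2 : IsEmpty {x : SizeOneRun n // permWord x.1.1 x.1.2 = 0} := ⟨fun x => by
      obtain ⟨-, -, -, -, -, h⟩ := x.1.2
      rw [Nat.add_sub_cancel, x.2] at h
      omega⟩
    exact ⟨Equiv.equivOfIsEmpty _ _⟩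
  rcases Nat.lt_or_ge a n with h | h
  · obtain ⟨b, rfl⟩ : ∃ b, n = a + b + 1 := ⟨n - a - 1, by omega⟩
    simp only [add_left_inj]
    have h1 := PointedTableau.card_cutTriplet_fiber a b
    have h2 := card_sizeOneRun_fiber a b
    -- `Nat.card` is `0` on infinite types, so a nonzero count also proves finiteness, without which
    -- equal values would not give a bijection.
    have h3 := (PointedTableau.cornerCount_pos a b).ne'
    have := Nat.finite_of_card_ne_zero (h1.trans_ne h3)
    have := Nat.finite_of_card_ne_zero (h2.trans_ne h3)
    exact (Finite.card_eq).1 (h1.trans h2.symm)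
  · have h1 : IsEmpty {t : CutTriplet n // t.Tl.size + 1 = a + 1} := ⟨fun t => by
      have := t.1.size_eq
      have := t.2
      omega⟩
    have h2 : IsEmpty {x : SizeOneRun n // permWord x.1.1 x.1.2 = a + 1} := ⟨fun x => by
      obtain ⟨-, h3, h4, -⟩ := x.1.2
      have h5 := permWord_succ x.1.1.1 ⟨x.1.1.2 - 1, by omega⟩
      simp only [Nat.sub_add_cancel h3] at h5
      have := (x.1.1.1 ⟨x.1.1.2 - 1, by omega⟩).2
      have := x.2
      omega⟩
    exact ⟨Equiv.equivOfIsEmpty _ _⟩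

theorem mainTheorem3 (n : ℕ) (hn : 1 ≤ n) :
    ∃ (bij : TreeLikeCorner n ≃ SizeOneRun n)
      (cut : TreeLikeCorner n ≃ CutTriplet n) (mix : CutTriplet n ≃ SizeOneRun n),
      -- the bijection factors through the cutting of a tableau at its corner
      bij = cut.trans mix ∧
      (∀ x : TreeLikeCorner n,
        PointedTableau.IsCutLeft x.1.1 x.1.2 (cut x).Tl ∧
        PointedTableau.IsCutRight x.1.1 x.1.2 (cut x).Tr ∧
        PointedTableau.IsCutMiddle x.1.1 x.1.2 (cut x).N) ∧
      -- the run associated with `(Tl, Tr, N)` is the letter `size Tl + 1`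
      (∀ t : CutTriplet n, permWord (mix t).1.1 (mix t).1.2 = t.Tl.size + 1) := by
  obtain ⟨cut, hcut⟩ := exists_cut_equiv n
  -- Bijections chosen fibre by fibre over the common value `c`, which is `t.Tl.size + 1` or the
  -- letter of the run, glue to one that respects this value.
  have e := fun c => (nonempty_fiber_equiv n c).some
  exact ⟨_, cut, Equiv.ofFiberEquiv e, rfl, hcut, Equiv.ofFiberEquiv_map e⟩
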